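/- For $\lambda\in\mathbb C\setminus((-\infty,0]\cup[1,\infty))$ put $$\varpi_0(\lambda)=\frac1\pi\int_0^1\frac{dz}{\sqrt{z(1-z)(1-\lambda z)}},\qquad \varpi_1(\lambda)=-\frac1{\pi i}\int_\lambda^1\frac{dx}{\sqrt{x(1-x)(x-\lambda)}}$$ (straight segments; the square root of each product is the product of the principal square roots of its factors), $\pi_j=4\lambda(\lambda-1)\varpi_j'$ for $j=0,1$, and $\varphi=\pi_1/\pi_0$. For $u\in\mathbb C\setminus((-\infty,-1]\cup[1,\infty))$ let $a$ and $a_D$ be the periods of the Seiberg--Witten one-form $\frac{\sqrt2}{2\pi}\frac{(x-u)\,dx}{y}$ on the curve $y^2=(x-1)(x+1)(x-u)$ given by $$a_D(u)=2\int_u^1\frac{\sqrt2}{2\pi}\frac{(x-u)\,dx}{i\sqrt{1-x}\sqrt{1+x}\sqrt{x-u}},\qquad a(u)=a_D(u)+2\int_u^{-1}\frac{\sqrt2}{2\pi}\frac{(x-u)\,dx}{\sqrt{1-x}\sqrt{1+x}\sqrt{u-x}}$$ (so that $a=-\pi_0-\pi_1$ and $a_D=-\pi_1$ at $\lambda=(u+1)/2$).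 Near $\lambda=0$ or $1$ (respectively $u=\mp1$) the pairs $(\pi_0,\pi_1)$ and $(a,a_D)$, hence $\varphi$ and $a_D/a$, are regarded as multi-valued: their branches at a point of a punctured neighbourhood are those obtained from the functions above by analytic continuation along paths inside that punctured neighbourhood. 1. There are $r>0$ and a holomorphic function $F$ on $|\lambda|<r$ with $F(\lambda)=e^{-3/2}\lambda+O(\lambda^2)$ as $\lambda\to0$ such that at every $\lambda$ with $0<|\lambda|<r$ branches exist, and every branch satisfies $\pi_0(\lambda)\ne0$ and $$16\,e^{\pi i\varphi(\lambda)}=F(\lambda)\,e^{4/\lambda}.$$ The function $F(\lambda)e^{4/\lambda}$ has an essential singularity at $\lambda=0$, and in every punctured neighbourhood of $0$ it takes every complex value, with at most one exception, infinitely many times. 2. In every punctured neighbourhood of $\lambda=0$, $\varphi$ takes every real value, with at most one exception, at infinitely many points (a value is taken at a point if some branch takes it there). Likewise $a_D/a$ takes every real value, with at most one exception, at infinitely many points of every punctured neighbourhood of $u=-1$. 3. The point $\lambda=1$ is obtained by the transformation $\lambda\mapsto1-\lambda$, $\varphi\mapsto-1/\varphi$: with the same $r$ and $F$, at every $\lambda$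 with $0<|\lambda-1|<r$ branches exist, and every branch satisfies $\pi_1(\lambda)\ne0$ and $16\,e^{-\pi i\,\pi_0(\lambda)/\pi_1(\lambda)}=F(1-\lambda)\,e^{4/(1-\lambda)}$. In every punctured neighbourhood of $\lambda=1$, $\varphi$ takes every real value, with at most one exception, at infinitely many points, and so does $a_D/a$ in every punctured neighbourhood of $u=1$. -/

import Mathlib

open Filter Topology Set Metric

noncomputable section

namespace SeibergWitten

/-- The integral of `f(x) dx` along the straight segment from `p` to `q`. -/
def segmentIntegral (f : ℂ → ℂ) (p q : ℂ) : ℂ :=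
  ∫ s in (0 : ℝ)..1, f (p + (s : ℂ) * (q - p)) * (q - p)

/-! ### Periods of the Legendre family `y² = x (x - 1) (x - lam)`

The principal branches live on `ℂ ∖ ((-∞, 0] ∪ [1, ∞))`.  Square roots of products are taken factor
by factor; on that domain no factor meets the branch cut of the principal square root. -/

/-- The plane with the two half-lines `(-∞, 0]` and `[1, ∞)` removed. -/
def legendreDomain : Set ℂ :=
  {lam | lam ∈ Complex.slitPlane ∧ 1 - lam ∈ Complex.slitPlane}

/-- `ϖ₀(lam) = (1/π) ∫₀¹ dz / √(z (1 - z) (1 - lam z))`. -/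
def varpi0 (lam : ℂ) : ℂ :=
  1 / (Real.pi : ℂ) * segmentIntegral
    (fun z => 1 / (Complex.sqrt z * Complex.sqrt (1 - z) * Complex.sqrt (1 - lam * z))) 0 1

/-- `ϖ₁(lam) = - (1/(π i)) ∫_lam^1 dx / √(x (1 - x) (x - lam))`. -/
def varpi1 (lam : ℂ) : ℂ :=
  -(1 / ((Real.pi : ℂ) * Complex.I)) * segmentIntegral
    (fun x => 1 / (Complex.sqrt x * Complex.sqrt (1 - x) * Complex.sqrt (x - lam))) lam 1

/-- The BPS periods `(π₀, π₁)`, with `πᵢ = 4 lam (lam - 1) ϖᵢ'`. The Seiberg-Witten period is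
`φ = π₁ / π₀`. -/
def bpsPeriods (lam : ℂ) : ℂ × ℂ :=
  (4 * lam * (lam - 1) * deriv varpi0 lam, 4 * lam * (lam - 1) * deriv varpi1 lam)

/-! ### Periods of the Seiberg-Witten one-form on `y² = (x - 1) (x + 1) (x - u)` -/

/-- The plane with the two half-lines `(-∞, -1]` and `[1, ∞)` removed. -/
def swDomain : Set ℂ :=
  {u | 1 + u ∈ Complex.slitPlane ∧ 1 - u ∈ Complex.slitPlane}

/-- The coefficient of `dx` in the one-form `Ω = (√2 / 2π) (x - u) dx / y`. -/
def swForm (u x y : ℂ) : ℂ :=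
  (Real.sqrt 2 : ℂ) / (2 * (Real.pi : ℂ)) * ((x - u) / y)

/-- A branch of `y` over the segment from `u` to `-1`. -/
def yLeft (u x : ℂ) : ℂ := Complex.sqrt (1 - x) * Complex.sqrt (1 + x) * Complex.sqrt (u - x)

/-- A branch of `y` over the segment from `u` to `1`. -/
def yRight (u x : ℂ) : ℂ :=
  Complex.I * (Complex.sqrt (1 - x) * Complex.sqrt (1 + x) * Complex.sqrt (x - u))

lemma sqrt_mul_self (z : ℂ) : Complex.sqrt z * Complex.sqrt z = z := by
  rw [Complex.sqrt, ← pow_two, ← Complex.cpow_nat_mul]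
  simp

lemma yLeft_sq (u x : ℂ) : yLeft u x ^ 2 = (x - 1) * (x + 1) * (x - u) := by
  have h1 := sqrt_mul_self (1 - x)
  have h2 := sqrt_mul_self (1 + x)
  have h3 := sqrt_mul_self (u - x)
  calc yLeft u x ^ 2 = (Complex.sqrt (1 - x) * Complex.sqrt (1 - x)) *
        (Complex.sqrt (1 + x) * Complex.sqrt (1 + x)) *
        (Complex.sqrt (u - x) * Complex.sqrt (u - x)) := by unfold yLeft; ring
    _ = (x - 1) * (x + 1) * (x - u) := by rw [h1, h2, h3]; ring

lemma yRight_sq (u x : ℂ) : yRight u x ^ 2 = (x - 1) * (x + 1) * (x - u) := by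
  have h1 := sqrt_mul_self (1 - x)
  have h2 := sqrt_mul_self (1 + x)
  have h3 := sqrt_mul_self (x - u)
  calc yRight u x ^ 2 = Complex.I ^ 2 * ((Complex.sqrt (1 - x) * Complex.sqrt (1 - x)) *
        (Complex.sqrt (1 + x) * Complex.sqrt (1 + x)) *
        (Complex.sqrt (x - u) * Complex.sqrt (x - u))) := by unfold yRight; ring
    _ = (x - 1) * (x + 1) * (x - u) := by rw [h1, h2, h3, Complex.I_sq]; ring

/-- The period of `Ω` over the cycle that runs from `u` to `-1` on one sheet and returns on the
other. -/
def leftPeriod (u : ℂ) : ℂ :=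
  2 * segmentIntegral (fun x => swForm u x (yLeft u x)) u (-1)

/-- The period of `Ω` over the cycle that runs from `u` to `1` on one sheet and returns on the
other. -/
def rightPeriod (u : ℂ) : ℂ :=
  2 * segmentIntegral (fun x => swForm u x (yRight u x)) u 1

/-- The pair `(a, a_D)`: with `lam = (u + 1) / 2` the two cycles above are `-γ₀` and `-γ₁`, where
`γ₀, γ₁` are the cycles of `ϖ₀, ϖ₁`, so that `a` is the period over `-γ₀ - γ₁` and `a_D` the period
over `-γ₁`. -/
def swPeriods (u : ℂ) : ℂ × ℂ := (leftPeriod u + rightPeriod u, rightPeriod u)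

/-! ### Multi-valued functions and essential singularities -/

/-- `g` is a branch at `z` of the multi-valued function obtained from `f` (single-valued on `U`) by
analytic continuation along paths inside `D`: there are a path in `D` from a point of `U` to `z` and
analytic germs along it, locally compatible, from the germ of `f` to the germ of `g`. -/
def IsBranchAt (f : ℂ → ℂ × ℂ) (U D : Set ℂ) (z : ℂ) (g : ℂ → ℂ × ℂ) : Prop :=
  ∃ z₀ ∈ U, ∃ γ : Path z₀ z, (∀ t, γ t ∈ D) ∧
    ∃ G : unitInterval → ℂ → ℂ × ℂ,
      (∀ t, AnalyticAt ℂ (G t) (γ t)) ∧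
      (∀ t, ∀ᶠ s in 𝓝 t, G s =ᶠ[𝓝 (γ s)] G t) ∧
      G 0 =ᶠ[𝓝 z₀] f ∧ G 1 =ᶠ[𝓝 z] g

/-- The points of `D` at which the quotient (second component) / (first component) of some branch,
continued inside `D`, is defined and equal to `t`. -/
def quotientFiber (f : ℂ → ℂ × ℂ) (U D : Set ℂ) (t : ℂ) : Set ℂ :=
  {z | z ∈ D ∧ ∃ g, IsBranchAt f U D z g ∧ (g z).1 ≠ 0 ∧ (g z).2 / (g z).1 = t}

/-- `G` has an isolated singularity at `z₀` that is neither removable nor a pole. -/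
def HasEssentialSingularityAt (G : ℂ → ℂ) (z₀ : ℂ) : Prop :=
  (∀ᶠ z in 𝓝[≠] z₀, DifferentiableAt ℂ G z) ∧ ¬ MeromorphicAt G z₀

/-- Inside every neighbourhood of `z₀` punctured at `z₀`, the multi-valued quotient of the
components of `f` takes every real value, with at most one exception, at infinitely many points. -/
def TakesRealValuesNear (f : ℂ → ℂ × ℂ) (U : Set ℂ) (z₀ : ℂ) : Prop :=
  ∃ e : ℝ, ∀ N ∈ 𝓝 z₀, ∀ t : ℝ, t ≠ e → (quotientFiber f U (N \ {z₀}) (t : ℂ)).Infinite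

end SeibergWitten

end

/-! Everything is reduced to one function, the complete elliptic integral `varpi0`. The substitution
z = sin² θ turns it into `sinInt`, which can be differentiated under the integral sign, and `varpi1
lam = I * varpi0 (1 - lam)` on the domain. Integration by parts gives the hypergeometric equation,
which is symmetric under lam ↦ 1 - lam. The Wronskian of `varpi0` and its reflection is therefore
constant, so their quotient is an affine function of log lam + k(lam) with k holomorphic at 0. The
real asymptotics π ϖ₀(1 - x) = -log x + log 16 + o(1) fix both constants
(`exists_connection_formula`).

Differentiating this connection formula gives π i φ = log lam + m(lam) + 4 / lam with m holomorphic
and m(0) = -log 16 - 3/2 (`exists_log_structure`). Hence F = 16 lam exp(m(lam)). The exponential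
relation is single-valued, and it passes to all branches by permanence of analytic relations
(`IsBranchAt.relation`).

The value distribution does not rest on Picard's theorem. With w = 1 / lam, the equation F exp(4 /
lam) = c ≠ 0 becomes 4 w - log w + m(1/w) = C + 2 π i n. A quantitative open mapping theorem solves
it for all large n (`eventually_exists_sub_log_eq`). Taking c = 16 exp(π i t) yields a point z
together with a logarithm of z whose branch has φ = t exactly (`exists_isBranchAt`), so near 0 every
complex t is attained. The other three points follow by affine changes of variable and linear maps
of the periods. These act on φ by Möbius maps, and the only value that may be lost is the image of φ
= ∞. -/

open Filter Topology Set Metric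

noncomputable section

namespace SeibergWitten

/-! ### Trigonometric form of the period integrals. -/

/-- The parameters for which `1 - lam s` avoids the branch cut for every `s ∈ [0, 1]`. -/
def oneSubSlit : Set ℂ := {lam | 1 - lam ∈ Complex.slitPlane}

lemma isOpen_oneSubSlit : IsOpen oneSubSlit :=
  Complex.isOpen_slitPlane.preimage (continuous_const.sub continuous_id)

lemma one_sub_mul_mem_slitPlane {lam : ℂ} (h : lam ∈ oneSubSlit) {s : ℝ} (h0 : 0 ≤ s)
    (h1 : s ≤ 1) : 1 - lam * s ∈ Complex.slitPlane := by
  have := Complex.starConvex_one_slitPlane h (a := 1 - s) (b := s) (by linarith) h0 (by ring)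
  convert this using 1
  simp
  ring

lemma one_sub_mul_sin_sq_mem {lam : ℂ} (h : lam ∈ oneSubSlit) (θ : ℝ) :
    1 - lam * (Real.sin θ : ℂ) ^ 2 ∈ Complex.slitPlane := by
  have := one_sub_mul_mem_slitPlane h (sq_nonneg (Real.sin θ)) (Real.sin_sq_le_one θ)
  exact_mod_cast this

/-- The weighted elliptic-type integral `∫ w(θ) (1 - lam sin² θ)^a dθ` over a quarter period. -/
def sinInt (a : ℂ) (w : ℝ → ℂ) (lam : ℂ) : ℂ :=
  ∫ θ in (0 : ℝ)..(Real.pi / 2), w θ * (1 - lam * (Real.sin θ : ℂ) ^ 2) ^ a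

lemma continuous_sinInt_integrand {a : ℂ} {w : ℝ → ℂ} (hw : Continuous w) {lam : ℂ}
    (h : lam ∈ oneSubSlit) :
    Continuous fun θ : ℝ => w θ * (1 - lam * (Real.sin θ : ℂ) ^ 2) ^ a := by
  refine hw.mul (Continuous.cpow (by fun_prop) continuous_const fun θ => ?_)
  exact one_sub_mul_sin_sq_mem h θ

/-- Differentiation under the integral sign, with a constant bound from compactness. The family
`sinInt` is closed under it, so `varpi0` and its derivatives are all of this form. -/
lemma hasDerivAt_sinInt {a : ℂ} {w : ℝ → ℂ} (hw : Continuous w) {lam : ℂ}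
    (h : lam ∈ oneSubSlit) :
    HasDerivAt (sinInt a w)
      (sinInt (a - 1) (fun θ => -a * (Real.sin θ : ℂ) ^ 2 * w θ) lam) lam := by
  obtain ⟨ε, hε, hball⟩ := Metric.nhds_basis_closedBall.mem_iff.1 (isOpen_oneSubSlit.mem_nhds h)
  have hcont : ContinuousOn (fun p : ℂ × ℝ => -a * (Real.sin p.2 : ℂ) ^ 2 * w p.2 *
      (1 - p.1 * (Real.sin p.2 : ℂ) ^ 2) ^ (a - 1)) (closedBall lam ε ×ˢ Icc 0 (Real.pi / 2)) := by
    refine ContinuousOn.mul (by fun_prop) (ContinuousOn.cpow (by fun_prop) continuousOn_const ?_)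
    rintro ⟨l, θ⟩ ⟨hl, -⟩
    exact one_sub_mul_sin_sq_mem (hball hl) θ
  obtain ⟨C, hC⟩ := ((isCompact_closedBall lam ε).prod isCompact_Icc).exists_bound_of_continuousOn
    hcont
  have hpi : (0 : ℝ) ≤ Real.pi / 2 := by positivity
  refine (intervalIntegral.hasDerivAt_integral_of_dominated_loc_of_deriv_le
    (F := fun l θ => w θ * (1 - l * (Real.sin θ : ℂ) ^ 2) ^ a)
    (F' := fun l θ => -a * (Real.sin θ : ℂ) ^ 2 * w θ * (1 - l * (Real.sin θ : ℂ) ^ 2) ^ (a - 1))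
    (bound := fun _ => C) (closedBall_mem_nhds lam hε) ?_ ?_ ?_ ?_ ?_ ?_).2
  · filter_upwards [isOpen_oneSubSlit.mem_nhds h] with l hl
    exact (continuous_sinInt_integrand hw hl).aestronglyMeasurable
  · exact (continuous_sinInt_integrand hw h).intervalIntegrable _ _
  · exact (continuous_sinInt_integrand (by fun_prop) h).aestronglyMeasurable
  · refine .of_forall fun θ hθ l hl => hC (l, θ) ⟨hl, ?_⟩
    rw [uIoc_of_le hpi] at hθ
    exact Ioc_subset_Icc_self hθ
  · exact intervalIntegrable_const
  · refine .of_forall fun θ _ l hl => ?_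
    have h1 : HasDerivAt (fun l : ℂ => 1 - l * (Real.sin θ : ℂ) ^ 2) (-(Real.sin θ : ℂ) ^ 2) l := by
      simpa using ((hasDerivAt_id l).mul_const ((Real.sin θ : ℂ) ^ 2)).const_sub 1
    refine ((h1.cpow_const (c := a) (one_sub_mul_sin_sq_mem (hball hl) θ)).const_mul
      (w θ)).congr_deriv ?_
    ring

lemma sinInt_const_mul (a c : ℂ) (w : ℝ → ℂ) (lam : ℂ) :
    sinInt a (fun θ => c * w θ) lam = c * sinInt a w lam := by
  simp only [sinInt, mul_assoc]
  exact intervalIntegral.integral_const_mul _ _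

/-- The integral of a total derivative `d/dθ (sin θ cos θ (1 - lam sin² θ)^a)` vanishes. -/
lemma sinInt_total_derivative (a : ℂ) {lam : ℂ} (h : lam ∈ oneSubSlit) :
    sinInt (a - 1) (fun θ => (1 - 2 * (Real.sin θ : ℂ) ^ 2) * (1 - lam * (Real.sin θ : ℂ) ^ 2)
      - 2 * a * lam * ((Real.sin θ : ℂ) ^ 2 * (1 - (Real.sin θ : ℂ) ^ 2))) lam = 0 := by
  have key : ∀ θ : ℝ, HasDerivAt (fun θ : ℝ => (Real.sin θ : ℂ) * (Real.cos θ : ℂ) *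
      (1 - lam * (Real.sin θ : ℂ) ^ 2) ^ a)
      (((1 - 2 * (Real.sin θ : ℂ) ^ 2) * (1 - lam * (Real.sin θ : ℂ) ^ 2)
      - 2 * a * lam * ((Real.sin θ : ℂ) ^ 2 * (1 - (Real.sin θ : ℂ) ^ 2))) *
        (1 - lam * (Real.sin θ : ℂ) ^ 2) ^ (a - 1)) θ := by
    intro θ
    have hs := (Real.hasDerivAt_sin θ).ofReal_comp
    have hc := (Real.hasDerivAt_cos θ).ofReal_comp
    have hm := one_sub_mul_sin_sq_mem h θ
    have hD : HasDerivAt (fun θ : ℝ => 1 - lam * (Real.sin θ : ℂ) ^ 2)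
        (-(lam * (2 * (Real.sin θ : ℂ) * Real.cos θ))) θ := by
      simpa using ((hs.pow 2).const_mul lam).const_sub 1
    have hp := (Complex.hasStrictDerivAt_cpow_const (c := a) hm).hasDerivAt.comp θ hD
    refine ((hs.mul hc).mul hp).congr_deriv ?_
    have hne := Complex.slitPlane_ne_zero hm
    have h2 : (Real.cos θ : ℂ) ^ 2 = 1 - (Real.sin θ : ℂ) ^ 2 := by
      rw [eq_sub_iff_add_eq]; exact_mod_cast Real.cos_sq_add_sin_sq θ
    have h3 : (1 - lam * (Real.sin θ : ℂ) ^ 2) ^ a =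
        (1 - lam * (Real.sin θ : ℂ) ^ 2) ^ (a - 1) * (1 - lam * (Real.sin θ : ℂ) ^ 2) := by
      rw [Complex.cpow_sub _ _ hne, Complex.cpow_one, div_mul_cancel₀ _ hne]
    simp only [Pi.mul_apply, Function.comp_apply, h3]
    push_cast at h2 ⊢
    linear_combination ((1 - lam * Complex.sin ↑θ ^ 2) ^ (a - 1) * ((1 - lam * Complex.sin ↑θ ^ 2)
      - 2 * a * lam * Complex.sin θ ^ 2)) * h2
  rw [sinInt, intervalIntegral.integral_eq_sub_of_hasDerivAt (fun θ _ => key θ)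
    ((continuous_sinInt_integrand (by fun_prop) h).intervalIntegrable _ _)]
  simp

lemma sinInt_add {a : ℂ} {v w : ℝ → ℂ} (hv : Continuous v) (hw : Continuous w) {lam : ℂ}
    (h : lam ∈ oneSubSlit) :
    sinInt a (fun θ => v θ + w θ) lam = sinInt a v lam + sinInt a w lam := by
  simp only [sinInt, add_mul]
  exact intervalIntegral.integral_add
    ((continuous_sinInt_integrand hv h).intervalIntegrable _ _)
    ((continuous_sinInt_integrand hw h).intervalIntegrable _ _)

lemma sinInt_eq_sub_one (a : ℂ) (w : ℝ → ℂ) {lam : ℂ} (h : lam ∈ oneSubSlit) :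
    sinInt a w lam =
      sinInt (a - 1) (fun θ => w θ * (1 - lam * (Real.sin θ : ℂ) ^ 2)) lam := by
  refine intervalIntegral.integral_congr fun θ _ => ?_
  have hne := Complex.slitPlane_ne_zero (one_sub_mul_sin_sq_mem h θ)
  change w θ * (1 - lam * (Real.sin θ : ℂ) ^ 2) ^ a = w θ * (1 - lam * (Real.sin θ : ℂ) ^ 2) *
    (1 - lam * (Real.sin θ : ℂ) ^ 2) ^ (a - 1)
  rw [Complex.cpow_sub _ _ hne, Complex.cpow_one]
  field_simp

/-- A nonnegative real factor does not change the argument, so the principal root is multiplicative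
here although it is not in general. Along the segments used below only such factors have to be split
off. -/
lemma sqrt_ofReal_mul {r : ℝ} (hr : 0 ≤ r) (z : ℂ) :
    Complex.sqrt (r * z) = (√r : ℂ) * Complex.sqrt z := by
  rcases hr.eq_or_lt with rfl | hr
  · simp
  rcases eq_or_ne z 0 with rfl | hz
  · simp
  have hr' : (r : ℂ) ≠ 0 := by exact_mod_cast hr.ne'
  rw [Complex.sqrt, Complex.sqrt, Complex.cpow_def_of_ne_zero (mul_ne_zero hr' hz),
    Complex.cpow_def_of_ne_zero hz, Complex.log_ofReal_mul hr hz, add_mul, Complex.exp_add,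
    Real.sqrt_eq_rpow, Complex.ofReal_cpow hr.le, Complex.cpow_def_of_ne_zero hr',
    Complex.ofReal_log hr.le]
  norm_num

lemma sqrt_ofReal {r : ℝ} (hr : 0 ≤ r) : Complex.sqrt r = (√r : ℂ) := by
  simpa using sqrt_ofReal_mul hr 1

/-- The substitution `z = sin² θ`. -/
lemma integral_div_sqrt_mul_sqrt (k : ℝ → ℂ) :
    ∫ s in (0 : ℝ)..1, k s / ((√s : ℂ) * (√(1 - s) : ℂ)) =
      2 * ∫ θ in (0 : ℝ)..(Real.pi / 2), k (Real.sin θ ^ 2) := by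
  have hsin : ∀ θ ∈ Ioo (0 : ℝ) (Real.pi / 2), 0 < Real.sin θ := fun θ hθ =>
    Real.sin_pos_of_pos_of_lt_pi hθ.1 (by linarith [hθ.2, Real.pi_pos])
  have hcos : ∀ θ ∈ Ioo (0 : ℝ) (Real.pi / 2), 0 < Real.cos θ := fun θ hθ =>
    Real.cos_pos_of_mem_Ioo ⟨by linarith [hθ.1, Real.pi_pos], hθ.2⟩
  have hinj : InjOn (fun θ => Real.sin θ ^ 2) (Ioo (0 : ℝ) (Real.pi / 2)) := by
    intro x hx y hy hxy
    have h1 : Real.sin x = Real.sin y :=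
      (pow_left_inj₀ (hsin x hx).le (hsin y hy).le two_ne_zero).1 hxy
    exact Real.strictMonoOn_sin.injOn ⟨by linarith [hx.1, Real.pi_pos], hx.2.le⟩
      ⟨by linarith [hy.1, Real.pi_pos], hy.2.le⟩ h1
  have himage : (fun θ => Real.sin θ ^ 2) '' Ioo (0 : ℝ) (Real.pi / 2) = Ioo 0 1 := by
    ext y
    constructor
    · rintro ⟨θ, hθ, rfl⟩
      have h1 := Real.sin_sq_add_cos_sq θ
      exact ⟨pow_pos (hsin θ hθ) 2, by nlinarith [pow_pos (hcos θ hθ) 2]⟩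
    · rintro ⟨h0, h1⟩
      refine ⟨Real.arcsin √y, ⟨Real.arcsin_pos.2 (Real.sqrt_pos.2 h0),
        Real.arcsin_lt_pi_div_two.2 ?_⟩, ?_⟩
      · rw [Real.sqrt_lt' one_pos]; simpa using h1
      · have : √y ≤ 1 := Real.sqrt_le_one.2 h1.le
        change Real.sin (Real.arcsin √y) ^ 2 = y
        rw [Real.sin_arcsin (by linarith [Real.sqrt_nonneg y]) this, Real.sq_sqrt h0.le]
  have hderiv : ∀ θ ∈ Ioo (0 : ℝ) (Real.pi / 2), HasDerivWithinAt (fun θ => Real.sin θ ^ 2)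
      (2 * Real.sin θ * Real.cos θ) (Ioo (0 : ℝ) (Real.pi / 2)) θ := fun θ _ => by
    exact (((Real.hasDerivAt_sin θ).fun_pow 2).congr_deriv (by norm_num)).hasDerivWithinAt
  have hpi : (0 : ℝ) ≤ Real.pi / 2 := by positivity
  rw [intervalIntegral.integral_of_le zero_le_one, intervalIntegral.integral_of_le hpi,
    MeasureTheory.integral_Ioc_eq_integral_Ioo, MeasureTheory.integral_Ioc_eq_integral_Ioo,
    ← himage, MeasureTheory.integral_image_eq_integral_abs_deriv_smul measurableSet_Ioo hderiv hinj,
    ← MeasureTheory.integral_const_mul]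
  refine MeasureTheory.setIntegral_congr_fun measurableSet_Ioo fun θ hθ => ?_
  have hs := hsin θ hθ
  have hc := hcos θ hθ
  have h1 : 1 - Real.sin θ ^ 2 = Real.cos θ ^ 2 := by linarith [Real.sin_sq_add_cos_sq θ]
  have hs' : (Real.sin θ : ℂ) ≠ 0 := by exact_mod_cast hs.ne'
  have hc' : (Real.cos θ : ℂ) ≠ 0 := by exact_mod_cast hc.ne'
  simp only [h1, Real.sqrt_sq hs.le, Real.sqrt_sq hc.le, Complex.real_smul,
    abs_of_pos (mul_pos (mul_pos two_pos hs) hc), Complex.ofReal_mul]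
  field_simp
  norm_num
  ring

lemma integral_eq_sinInt (w : ℝ → ℂ) (lam : ℂ) :
    ∫ s in (0 : ℝ)..1, w s / ((√s : ℂ) * (√(1 - s) : ℂ) * Complex.sqrt (1 - lam * s)) =
      2 * sinInt (-1 / 2) (fun θ => w (Real.sin θ ^ 2)) lam := by
  have := integral_div_sqrt_mul_sqrt fun s => w s * (1 - lam * s) ^ (-1 / 2 : ℂ)
  push_cast at this
  simp only [sinInt, Complex.ofReal_sin]
  rw [← this]
  congr 1
  ext s
  rw [neg_div, Complex.cpow_neg, Complex.sqrt]
  norm_num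
  simp only [div_eq_mul_inv, mul_inv]
  ring

lemma varpi0_eq (lam : ℂ) :
    varpi0 lam = 2 / (Real.pi : ℂ) * sinInt (-1 / 2) (fun _ => 1) lam := by
  have h : segmentIntegral
      (fun z => 1 / (Complex.sqrt z * Complex.sqrt (1 - z) * Complex.sqrt (1 - lam * z))) 0 1 =
      ∫ s in (0 : ℝ)..1, 1 / ((√s : ℂ) * (√(1 - s) : ℂ) * Complex.sqrt (1 - lam * s)) := by
    refine intervalIntegral.integral_congr fun s hs => ?_
    rw [uIcc_of_le zero_le_one] at hs
    have h1 : (1 : ℂ) - s = ((1 - s : ℝ) : ℂ) := by push_cast; ring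
    simp only [sub_zero, mul_one, zero_add]
    rw [h1, sqrt_ofReal hs.1, sqrt_ofReal (sub_nonneg.2 hs.2)]
  rw [varpi0, h, integral_eq_sinInt (fun _ => 1)]
  ring

/-- On x = lam + s (1 - lam) both 1 - x and x - lam are nonnegative real multiples of 1 - lam. The
two copies of √(1 - lam) multiply to 1 - lam and cancel dx; then s ↦ 1 - s gives the integral of
`varpi0`. -/
lemma varpi1_eq {lam : ℂ} (h : lam ≠ 1) : varpi1 lam = Complex.I * varpi0 (1 - lam) := by
  have hne : 1 - lam ≠ 0 := sub_ne_zero.2 h.symm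
  have key : segmentIntegral
      (fun x => 1 / (Complex.sqrt x * Complex.sqrt (1 - x) * Complex.sqrt (x - lam))) lam 1 =
      ∫ s in (0 : ℝ)..1, 1 / ((√s : ℂ) * (√(1 - s) : ℂ) * Complex.sqrt (1 - (1 - lam) * s)) := by
    have hrefl := intervalIntegral.integral_comp_sub_left (a := 0) (b := 1)
      (fun s : ℝ => 1 / ((√s : ℂ) * (√(1 - s) : ℂ) * Complex.sqrt (1 - (1 - lam) * s))) 1
    rw [sub_self, sub_zero] at hrefl
    rw [segmentIntegral, ← hrefl]
    refine intervalIntegral.integral_congr fun s hs => ?_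
    rw [uIcc_of_le zero_le_one] at hs
    have h1 : 1 - (lam + s * (1 - lam)) = ((1 - s : ℝ) : ℂ) * (1 - lam) := by push_cast; ring
    have h2 : lam + s * (1 - lam) - lam = (s : ℂ) * (1 - lam) := by ring
    have h3 : lam + s * (1 - lam) = 1 - (1 - lam) * ((1 - s : ℝ) : ℂ) := by push_cast; ring
    have h4 := sqrt_mul_self (1 - lam)
    have hs0 : Complex.sqrt (1 - lam) ≠ 0 := fun h0 => hne (by rw [← h4, h0, zero_mul])
    simp only [h1, h2, sqrt_ofReal_mul hs.1, sqrt_ofReal_mul (sub_nonneg.2 hs.2)]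
    rw [h3]
    have h5 : (1 : ℝ) - (1 - s) = s := by ring
    rw [h5]
    set q := Complex.sqrt (1 - lam)
    rw [← h4]
    simp only [div_eq_mul_inv, mul_inv]
    have : q⁻¹ * q = 1 := inv_mul_cancel₀ hs0
    generalize (Complex.sqrt (1 - q * q * ((1 - s : ℝ) : ℂ)))⁻¹ = y
    linear_combination (y * (√s : ℂ)⁻¹ * (√(1 - s) : ℂ)⁻¹) * (q⁻¹ * q + 1) * this
  rw [varpi1, key, integral_eq_sinInt (fun _ => 1), varpi0_eq]
  have hpi : (Real.pi : ℂ) ≠ 0 := by exact_mod_cast Real.pi_ne_zero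
  field_simp
  rw [Complex.I_sq]
  ring

/-! ### The hypergeometric equation and the Taylor coefficients at 0. -/

/-- The derivative of `varpi0`. -/
def varpi0' (lam : ℂ) : ℂ :=
  2 / (Real.pi : ℂ) * sinInt (-3 / 2) (fun θ => 1 / 2 * (Real.sin θ : ℂ) ^ 2) lam

/-- The second derivative of `varpi0`. -/
def varpi0'' (lam : ℂ) : ℂ :=
  2 / (Real.pi : ℂ) * sinInt (-5 / 2) (fun θ => 3 / 4 * (Real.sin θ : ℂ) ^ 4) lam

lemma hasDerivAt_varpi0 {lam : ℂ} (h : lam ∈ oneSubSlit) :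
    HasDerivAt varpi0 (varpi0' lam) lam := by
  have := (hasDerivAt_sinInt (a := -1 / 2) (w := fun _ => 1) continuous_const h).const_mul
    (2 / (Real.pi : ℂ))
  rw [show varpi0 = fun lam => 2 / (Real.pi : ℂ) * sinInt (-1 / 2) (fun _ => 1) lam from
    funext varpi0_eq, varpi0']
  refine this.congr_deriv ?_
  norm_num

lemma hasDerivAt_varpi0' {lam : ℂ} (h : lam ∈ oneSubSlit) :
    HasDerivAt varpi0' (varpi0'' lam) lam := by
  have := (hasDerivAt_sinInt (a := -3 / 2) (w := fun θ => 1 / 2 * (Real.sin θ : ℂ) ^ 2)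
    (by fun_prop) h).const_mul (2 / (Real.pi : ℂ))
  rw [varpi0'']
  refine this.congr_deriv ?_
  norm_num
  congr 1; ext; ring

/-- The hypergeometric differential equation of `varpi0`. -/
lemma varpi0_ode {lam : ℂ} (h : lam ∈ oneSubSlit) :
    lam * (1 - lam) * varpi0'' lam + (1 - 2 * lam) * varpi0' lam - varpi0 lam / 4 = 0 := by
  have h0 : sinInt (-1 / 2) (fun _ => 1) lam = sinInt (-5 / 2)
      (fun θ => (1 - lam * (Real.sin θ : ℂ) ^ 2) ^ 2) lam := by
    rw [sinInt_eq_sub_one _ _ h, sinInt_eq_sub_one _ _ h]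
    norm_num
    congr 1; ext; ring
  have h1 : sinInt (-3 / 2) (fun θ => 1 / 2 * (Real.sin θ : ℂ) ^ 2) lam = sinInt (-5 / 2)
      (fun θ => 1 / 2 * (Real.sin θ : ℂ) ^ 2 * (1 - lam * (Real.sin θ : ℂ) ^ 2)) lam := by
    rw [sinInt_eq_sub_one _ _ h]
    norm_num
  have h2 := sinInt_total_derivative (-3 / 2) h
  have h3 : lam * (1 - lam) * sinInt (-5 / 2) (fun θ => 3 / 4 * (Real.sin θ : ℂ) ^ 4) lam +
      ((1 - 2 * lam) * sinInt (-3 / 2) (fun θ => 1 / 2 * (Real.sin θ : ℂ) ^ 2) lam +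
      (-1 / 4) * sinInt (-1 / 2) (fun _ => 1) lam) = 0 := by
    rw [h0, h1, ← sinInt_const_mul, ← sinInt_const_mul, ← sinInt_const_mul,
      ← sinInt_add (by fun_prop) (by fun_prop) h, ← sinInt_add (by fun_prop) (by fun_prop) h]
    -- With all exponents equal to -5/2, the left side is -1/4 times the total derivative for a =
    -- -3/2.
    rw [← mul_zero (-1 / 4 : ℂ), ← h2, ← sinInt_const_mul]
    norm_num
    congr 1; ext; ring
  rw [varpi0_eq, varpi0', varpi0'']
  linear_combination 2 / (Real.pi : ℂ) * h3

lemma integral_ofReal_pow_sin (n : ℕ) (c : ℂ) :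
    ∫ θ in (0 : ℝ)..(Real.pi / 2), c * (Real.sin θ : ℂ) ^ n =
      c * ((∫ θ in (0 : ℝ)..(Real.pi / 2), Real.sin θ ^ n : ℝ) : ℂ) := by
  rw [intervalIntegral.integral_const_mul, ← intervalIntegral.integral_ofReal]
  push_cast
  rfl

lemma varpi0_zero : varpi0 0 = 1 := by
  have hpi : (Real.pi : ℂ) ≠ 0 := by exact_mod_cast Real.pi_ne_zero
  simp [varpi0_eq, sinInt]

lemma varpi0'_zero : varpi0' 0 = 1 / 4 := by
  have hpi : (Real.pi : ℂ) ≠ 0 := by exact_mod_cast Real.pi_ne_zero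
  have := integral_ofReal_pow_sin 2 (1 / 2)
  rw [integral_sin_pow] at this
  rw [varpi0', sinInt]
  simp only [zero_mul, sub_zero, Complex.one_cpow, mul_one, this]
  simp
  field_simp
  norm_num

lemma varpi0''_zero : varpi0'' 0 = 9 / 32 := by
  have hpi : (Real.pi : ℂ) ≠ 0 := by exact_mod_cast Real.pi_ne_zero
  have := integral_ofReal_pow_sin 4 (3 / 4)
  rw [integral_sin_pow, integral_sin_pow] at this
  rw [varpi0'', sinInt]
  simp only [zero_mul, sub_zero, Complex.one_cpow, mul_one, this]
  simp
  field_simp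
  norm_num

/-! ### The BPS periods and the duality lam ↦ 1 - lam. -/

lemma one_sub_mem_oneSubSlit {lam : ℂ} (h : lam ∈ Complex.slitPlane) : 1 - lam ∈ oneSubSlit := by
  simpa [oneSubSlit] using h

lemma one_sub_mem_legendreDomain {lam : ℂ} (h : lam ∈ legendreDomain) :
    1 - lam ∈ legendreDomain := ⟨h.2, by simpa using h.1⟩

lemma isOpen_legendreDomain : IsOpen legendreDomain :=
  Complex.isOpen_slitPlane.inter isOpen_oneSubSlit

lemma hasDerivAt_varpi1 {lam : ℂ} (h : lam ∈ legendreDomain) :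
    HasDerivAt varpi1 (-Complex.I * varpi0' (1 - lam)) lam := by
  have h1 : HasDerivAt (fun l => Complex.I * varpi0 (1 - l))
      (-Complex.I * varpi0' (1 - lam)) lam := by
    refine (((hasDerivAt_varpi0 (one_sub_mem_oneSubSlit h.1)).comp lam
      ((hasDerivAt_id lam).const_sub 1)).const_mul Complex.I).congr_deriv ?_
    ring
  refine h1.congr_of_eventuallyEq ?_
  filter_upwards [isOpen_legendreDomain.mem_nhds h] with l hl
  refine varpi1_eq fun h0 => ?_
  subst h0
  simp [legendreDomain] at hl

lemma bpsPeriods_eq {lam : ℂ} (h : lam ∈ legendreDomain) :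
    bpsPeriods lam = (4 * lam * (lam - 1) * varpi0' lam,
      -Complex.I * (4 * lam * (lam - 1) * varpi0' (1 - lam))) := by
  rw [bpsPeriods, (hasDerivAt_varpi0 h.2).deriv, (hasDerivAt_varpi1 h).deriv]
  congr 1
  ring

/-- The prefactor 4 lam (lam - 1) is invariant under the reflection, which exchanges the two
derivatives up to a factor ± i. This is φ ↦ -1/φ, and it carries every result at 0 over to 1. -/
lemma bpsPeriods_one_sub {lam : ℂ} (h : lam ∈ legendreDomain) :
    bpsPeriods (1 - lam) =
      (Complex.I * (bpsPeriods lam).2, -Complex.I * (bpsPeriods lam).1) := by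
  rw [bpsPeriods_eq h, bpsPeriods_eq (one_sub_mem_legendreDomain h)]
  simp only [sub_sub_cancel, Prod.mk.injEq]
  constructor
  · linear_combination (4 * lam * (lam - 1) * varpi0' (1 - lam)) * Complex.I_sq
  · ring

/-! ### The Seiberg-Witten periods in terms of the BPS periods. -/

/-- Integration by parts (a = -1/2 in `sinInt_total_derivative`). It trades the exponent -3/2 of
`varpi0'` for the -1/2 that occurs in the periods of the one-form. -/
lemma sinInt_cos_sq {lam : ℂ} (h : lam ∈ oneSubSlit) :
    sinInt (-1 / 2) (fun θ => 1 - (Real.sin θ : ℂ) ^ 2) lam =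
      (1 - lam) * sinInt (-3 / 2) (fun θ => (Real.sin θ : ℂ) ^ 2) lam := by
  have h1 : sinInt (-1 / 2) (fun θ => 1 - (Real.sin θ : ℂ) ^ 2) lam = sinInt (-3 / 2)
      (fun θ => (1 - (Real.sin θ : ℂ) ^ 2) * (1 - lam * (Real.sin θ : ℂ) ^ 2)) lam := by
    rw [sinInt_eq_sub_one _ _ h]
    norm_num
  have h2 := sinInt_total_derivative (-1 / 2) h
  have e : (-1 / 2 - 1 : ℂ) = -3 / 2 := by norm_num
  rw [e] at h2
  have h3 : sinInt (-3 / 2)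
      (fun θ => (1 - (Real.sin θ : ℂ) ^ 2) * (1 - lam * (Real.sin θ : ℂ) ^ 2)) lam +
      (-(1 - lam)) * sinInt (-3 / 2) (fun θ => (Real.sin θ : ℂ) ^ 2) lam = 0 := by
    rw [← sinInt_const_mul, ← sinInt_add (by fun_prop) (by fun_prop) h, ← h2]
    congr 1; ext; ring
  rw [h1]
  linear_combination h3

lemma four_mul_varpi0' {lam : ℂ} (h : lam ∈ oneSubSlit) :
    4 * lam * (1 - lam) * varpi0' lam = 2 * lam / (Real.pi : ℂ) *
      ∫ s in (0 : ℝ)..1, s /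
        ((√s : ℂ) * (√(1 - s) : ℂ) * Complex.sqrt (1 - lam * ((1 - s : ℝ) : ℂ))) := by
  have hrefl := intervalIntegral.integral_comp_sub_left (a := 0) (b := 1) (fun s : ℝ =>
    ((1 - s : ℝ) : ℂ) / ((√s : ℂ) * (√(1 - s) : ℂ) * Complex.sqrt (1 - lam * s))) 1
  rw [sub_self, sub_zero, integral_eq_sinInt (fun s => ((1 - s : ℝ) : ℂ))] at hrefl
  push_cast at hrefl
  have h1 := sinInt_cos_sq h
  push_cast at h1
  rw [h1] at hrefl
  have h2 : varpi0' lam = 2 / (Real.pi : ℂ) *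
      (1 / 2 * sinInt (-3 / 2) (fun θ => (Real.sin θ : ℂ) ^ 2) lam) := by
    rw [varpi0', sinInt_const_mul]
  push_cast at h2
  rw [h2]
  have h3 : (fun s : ℝ => (1 - (1 - (s : ℂ))) /
      ((√(1 - s) : ℂ) * (√(1 - (1 - s)) : ℂ) * Complex.sqrt (1 - lam * (1 - s)))) =
      fun s : ℝ => (s : ℂ) /
        ((√s : ℂ) * (√(1 - s) : ℂ) * Complex.sqrt (1 - lam * ((1 - s : ℝ) : ℂ))) := by
    ext s
    rw [sub_sub_cancel, sub_sub_cancel, mul_comm (√(1 - s) : ℂ)]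
    push_cast
    rfl
  rw [← h3, hrefl]
  ring

lemma sqrt_two_sq : ((√2 : ℝ) : ℂ) ^ 2 = 2 := by
  exact_mod_cast Real.sq_sqrt (zero_le_two (α := ℝ))

lemma sqrt_ne_zero {z : ℂ} (h : z ≠ 0) : Complex.sqrt z ≠ 0 := fun h0 =>
  h (by rw [← sqrt_mul_self z, h0, zero_mul])

/-- The product of the three square roots that occur along both cycles. -/
lemma sqrt_prod_eq (mu : ℂ) {s : ℝ} (h0 : 0 ≤ s) (h1 : s ≤ 1) :
    Complex.sqrt (((2 : ℝ) : ℂ) * (1 - mu * ((1 - s : ℝ) : ℂ))) *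
      Complex.sqrt (((2 * (1 - s) : ℝ) : ℂ) * mu) * Complex.sqrt (((2 * s : ℝ) : ℂ) * mu) =
    2 * ((√2 : ℝ) : ℂ) * mu * ((√s : ℂ) * (√(1 - s) : ℂ) *
      Complex.sqrt (1 - mu * ((1 - s : ℝ) : ℂ))) := by
  have h2 : (0 : ℝ) ≤ 2 := zero_le_two
  have h1' : 0 ≤ 1 - s := sub_nonneg.2 h1
  rw [sqrt_ofReal_mul h2, sqrt_ofReal_mul (mul_nonneg h2 h1'), sqrt_ofReal_mul (mul_nonneg h2 h0),
    Real.sqrt_mul h2, Real.sqrt_mul h2]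
  push_cast
  linear_combination (((√2 : ℝ) : ℂ) * (√s : ℂ) * (√(1 - s) : ℂ) *
      Complex.sqrt (1 - mu * (1 - s))) * (((√2 : ℝ) : ℂ) ^ 2 * sqrt_mul_self mu + mu * sqrt_two_sq)

lemma period_integrand_eq {mu : ℂ} (hmu : mu ≠ 0) (hmu' : mu ∈ oneSubSlit) {s : ℝ}
    (hs : s ∈ Ioo (0 : ℝ) 1) :
    2 * ((√2 : ℂ) / (2 * (Real.pi : ℂ)) * (2 * mu * s / (2 * ((√2 : ℝ) : ℂ) * mu *
      ((√s : ℂ) * (√(1 - s) : ℂ) * Complex.sqrt (1 - mu * ((1 - s : ℝ) : ℂ))))) * (2 * mu)) =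
    2 * mu / (Real.pi : ℂ) * (s / ((√s : ℂ) * (√(1 - s) : ℂ) *
      Complex.sqrt (1 - mu * ((1 - s : ℝ) : ℂ)))) := by
  have hpi : (Real.pi : ℂ) ≠ 0 := by exact_mod_cast Real.pi_ne_zero
  have h2 : ((√2 : ℝ) : ℂ) ≠ 0 := by exact_mod_cast (Real.sqrt_pos.2 two_pos).ne'
  have h3 : (√s : ℂ) ≠ 0 := by exact_mod_cast (Real.sqrt_pos.2 hs.1).ne'
  have h4 : (√(1 - s) : ℂ) ≠ 0 := by exact_mod_cast (Real.sqrt_pos.2 (sub_pos.2 hs.2)).ne'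
  have h5 := sqrt_ne_zero (Complex.slitPlane_ne_zero
    (one_sub_mul_mem_slitPlane hmu' (sub_pos.2 hs.2).le (by linarith [hs.1])))
  generalize Complex.sqrt (1 - mu * ((1 - s : ℝ) : ℂ)) = Y at *
  field_simp

lemma leftPeriod_eq {lam : ℂ} (h : lam ∈ legendreDomain) :
    leftPeriod (2 * lam - 1) = 4 * lam * (1 - lam) * varpi0' lam := by
  have hlam : lam ≠ 0 := Complex.slitPlane_ne_zero h.1
  rw [four_mul_varpi0' h.2, leftPeriod, segmentIntegral, ← intervalIntegral.integral_const_mul,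
    ← intervalIntegral.integral_const_mul]
  refine intervalIntegral.integral_congr_Ioo_of_le zero_le_one fun s hs => ?_
  have h1 : 1 - (2 * lam - 1 + s * (-1 - (2 * lam - 1))) =
    ((2 : ℝ) : ℂ) * (1 - lam * ((1 - s : ℝ) : ℂ)) := by push_cast; ring
  have h2 : 1 + (2 * lam - 1 + s * (-1 - (2 * lam - 1))) =
    ((2 * (1 - s) : ℝ) : ℂ) * lam := by push_cast; ring
  have h3 : 2 * lam - 1 - (2 * lam - 1 + s * (-1 - (2 * lam - 1))) =
    ((2 * s : ℝ) : ℂ) * lam := by push_cast; ring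
  have h4 : 2 * lam - 1 + s * (-1 - (2 * lam - 1)) - (2 * lam - 1) = -(2 * lam * s) := by ring
  simp only [swForm, yLeft]
  rw [h1, h2, h3, h4, sqrt_prod_eq lam hs.1.le hs.2.le, ← period_integrand_eq hlam h.2 hs]
  ring

lemma rightPeriod_eq {lam : ℂ} (h : lam ∈ legendreDomain) :
    rightPeriod (2 * lam - 1) = -Complex.I * (4 * lam * (1 - lam) * varpi0' (1 - lam)) := by
  have h' := one_sub_mem_legendreDomain h
  have hmu : 1 - lam ≠ 0 := Complex.slitPlane_ne_zero h'.1
  have key := four_mul_varpi0' h'.2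
  rw [sub_sub_cancel] at key
  rw [show 4 * lam * (1 - lam) * varpi0' (1 - lam) = 4 * (1 - lam) * lam * varpi0' (1 - lam) by
    ring, key, rightPeriod, segmentIntegral, ← intervalIntegral.integral_const_mul,
    ← intervalIntegral.integral_const_mul, ← intervalIntegral.integral_const_mul]
  refine intervalIntegral.integral_congr_Ioo_of_le zero_le_one fun s hs => ?_
  have h1 : 1 - (2 * lam - 1 + s * (1 - (2 * lam - 1))) =
    ((2 * (1 - s) : ℝ) : ℂ) * (1 - lam) := by push_cast; ring
  have h2 : 1 + (2 * lam - 1 + s * (1 - (2 * lam - 1))) =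
    ((2 : ℝ) : ℂ) * (1 - (1 - lam) * ((1 - s : ℝ) : ℂ)) := by push_cast; ring
  have h3 : 2 * lam - 1 + s * (1 - (2 * lam - 1)) - (2 * lam - 1) =
    ((2 * s : ℝ) : ℂ) * (1 - lam) := by push_cast; ring
  simp only [swForm, yRight]
  rw [h1, h2, h3, mul_comm (Complex.sqrt (((2 * (1 - s) : ℝ) : ℂ) * (1 - lam))),
    sqrt_prod_eq (1 - lam) hs.1.le hs.2.le, ← period_integrand_eq hmu h'.2 hs]
  have hI : ∀ w z : ℂ, w / (Complex.I * z) = -Complex.I * (w / z) := fun w z => by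
    rw [div_mul_eq_div_div, Complex.div_I]
    ring
  rw [hI]
  push_cast
  ring

lemma swPeriods_eq {lam : ℂ} (h : lam ∈ legendreDomain) :
    swPeriods (2 * lam - 1) =
      (-(bpsPeriods lam).1 - (bpsPeriods lam).2, -(bpsPeriods lam).2) := by
  rw [swPeriods, leftPeriod_eq h, rightPeriod_eq h, bpsPeriods_eq h]
  simp only [Prod.mk.injEq]
  constructor <;> ring

/-! ### Logarithmic asymptotics at the singular point 1. -/

lemma varpi0_one_sub_ofReal {x : ℝ} (hx : x ∈ Ioo (0 : ℝ) 1) :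
    varpi0 (1 - x) = ((1 / Real.pi * ∫ y in (0 : ℝ)..1,
      1 / (√y * √(1 - y) * √(x + (1 - x) * y)) : ℝ) : ℂ) := by
  have h1 : varpi0 (1 - x) = 1 / (Real.pi : ℂ) * ∫ s in (0 : ℝ)..1,
      1 / ((√s : ℂ) * (√(1 - s) : ℂ) * Complex.sqrt (1 - (1 - x) * s)) := by
    rw [integral_eq_sinInt (fun _ => 1), varpi0_eq]
    ring
  have hrefl := intervalIntegral.integral_comp_sub_left (a := 0) (b := 1)
      (fun s : ℝ => 1 / ((√s : ℂ) * (√(1 - s) : ℂ) * Complex.sqrt (1 - (1 - x) * s))) 1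
  rw [sub_self, sub_zero] at hrefl
  rw [h1, ← hrefl, Complex.ofReal_mul, ← intervalIntegral.integral_ofReal]
  push_cast
  congr 1
  refine intervalIntegral.integral_congr_Ioo_of_le zero_le_one fun y hy => ?_
  have h2 : 1 - (1 - (x : ℂ)) * (1 - y) = ((x + (1 - x) * y : ℝ) : ℂ) := by push_cast; ring
  have h3 : 0 ≤ x + (1 - x) * y := by nlinarith [hx.1, hx.2, hy.1]
  simp only [h2]
  rw [sqrt_ofReal h3, sub_sub_cancel, mul_comm (√(1 - y) : ℂ)]

/-- The singularity as x → 0 comes from y = 0 alone, so 1/√(1 - y) may be replaced by 1; what is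
left has an elementary antiderivative. Integrability follows because this antiderivative is
continuous with nonnegative derivative. -/
lemma integral_inv_sqrt_mul_sqrt {x : ℝ} (hx : x ∈ Ioo (0 : ℝ) 1) :
    IntervalIntegrable (fun y => 1 / (√y * √(x + (1 - x) * y))) MeasureTheory.volume 0 1 ∧
    ∫ y in (0 : ℝ)..1, 1 / (√y * √(x + (1 - x) * y)) =
      1 / √(1 - x) * (2 * Real.log (1 + √(1 - x)) - Real.log x) := by
  have hm : 0 < √(1 - x) := Real.sqrt_pos.2 (sub_pos.2 hx.2)
  have hpos : ∀ y ∈ Icc (0 : ℝ) 1, 0 < x + (1 - x) * y := fun y hy => by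
    nlinarith [hx.1, hx.2, mul_nonneg (sub_pos.2 hx.2).le hy.1]
  have hcont : ContinuousOn (fun y => 2 / √(1 - x) * Real.log (√(1 - x) * √y +
      √(x + (1 - x) * y))) (Icc 0 1) := by
    refine continuousOn_const.mul (ContinuousOn.log (by fun_prop) fun y hy => ?_)
    have := Real.sqrt_pos.2 (hpos y hy)
    positivity
  have hderiv : ∀ y ∈ Ioo (0 : ℝ) 1, HasDerivAt (fun y => 2 / √(1 - x) * Real.log (√(1 - x) * √y +
      √(x + (1 - x) * y))) (1 / (√y * √(x + (1 - x) * y))) y := fun y hy => by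
    have h0 := hpos y (Ioo_subset_Icc_self hy)
    have hp := Real.sqrt_pos.2 hy.1
    have hq := Real.sqrt_pos.2 h0
    have h1 : HasDerivAt (fun y => x + (1 - x) * y) (1 - x) y := by
      simpa using ((hasDerivAt_id y).const_mul (1 - x)).const_add x
    have h2 := ((Real.hasDerivAt_sqrt hy.1.ne').const_mul √(1 - x)).add (h1.sqrt h0.ne')
    refine ((h2.log (by simp only [Pi.add_apply]; positivity)).const_mul
      (2 / √(1 - x))).congr_deriv ?_
    have h3 : √(1 - x) * √(1 - x) = 1 - x := Real.mul_self_sqrt (sub_pos.2 hx.2).le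
    simp only [Pi.add_apply]
    have h4 : √(1 - x) * √y + √(x + (1 - x) * y) ≠ 0 := by positivity
    generalize √(x + (1 - x) * y) = q at *
    generalize √(1 - x) = m at *
    field_simp
    linear_combination (-√y) * h3
  have hint : IntervalIntegrable (fun y => 1 / (√y * √(x + (1 - x) * y)))
      MeasureTheory.volume 0 1 :=
    intervalIntegral.intervalIntegrable_deriv_of_nonneg (by rwa [uIcc_of_le zero_le_one])
      (by rwa [min_eq_left zero_le_one, max_eq_right zero_le_one]) (fun y _ => by positivity)
  refine ⟨hint, ?_⟩
  rw [intervalIntegral.integral_eq_sub_of_hasDerivAt_of_le zero_le_one hcont hderiv hint]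
  simp only [Real.sqrt_one, mul_one, Real.sqrt_zero, mul_zero, zero_add, add_zero,
    add_sub_cancel, Real.log_sqrt hx.1.le]
  rw [add_comm]
  ring

/-- The limit at x = 0 of the part with 1/√(1 - y) - 1. Its 2 log 2 and the 2 log 2 from
`integral_inv_sqrt_mul_sqrt` add up to log 16. -/
lemma integral_inv_sqrt_one_sub_sub_one_div :
    IntervalIntegrable (fun y => (1 / √(1 - y) - 1) / y) MeasureTheory.volume 0 1 ∧
    ∫ y in (0 : ℝ)..1, (1 / √(1 - y) - 1) / y = 2 * Real.log 2 := by
  have hcont : ContinuousOn (fun y => -2 * Real.log (1 + √(1 - y))) (Icc 0 1) := by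
    refine continuousOn_const.mul (ContinuousOn.log (by fun_prop) fun y hy => ?_)
    positivity
  have hderiv : ∀ y ∈ Ioo (0 : ℝ) 1, HasDerivAt (fun y => -2 * Real.log (1 + √(1 - y)))
      ((1 / √(1 - y) - 1) / y) y := fun y hy => by
    have h0 := sub_pos.2 hy.2
    have hq := Real.sqrt_pos.2 h0
    have h1 : HasDerivAt (fun y : ℝ => 1 - y) (-1) y := by
      simpa using (hasDerivAt_id y).const_sub 1
    refine ((((h1.sqrt h0.ne').const_add 1).log (by positivity)).const_mul (-2)).congr_deriv ?_
    have h3 : √(1 - y) * √(1 - y) = 1 - y := Real.mul_self_sqrt h0.le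
    have hy0 := hy.1.ne'
    field_simp
    nlinarith
  have hint : IntervalIntegrable (fun y => (1 / √(1 - y) - 1) / y) MeasureTheory.volume 0 1 :=
    intervalIntegral.intervalIntegrable_deriv_of_nonneg (by rwa [uIcc_of_le zero_le_one])
      (by rwa [min_eq_left zero_le_one, max_eq_right zero_le_one]) (fun y hy => by
      rw [min_eq_left zero_le_one, max_eq_right zero_le_one] at hy
      have hq := Real.sqrt_pos.2 (sub_pos.2 hy.2)
      refine div_nonneg (sub_nonneg.2 ?_) hy.1.le
      rw [le_div_iff₀ hq, one_mul, Real.sqrt_le_one]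
      linarith [hy.1])
  refine ⟨hint, ?_⟩
  rw [intervalIntegral.integral_eq_sub_of_hasDerivAt_of_le zero_le_one hcont hderiv hint]
  norm_num

/-- For x < 3/4 one has x + (1 - x) y ≥ y/4, so the remainder is dominated by twice its limit at x =
0. -/
lemma remainder_bound {x y : ℝ} (hx : x ∈ Ioo (0 : ℝ) (3 / 4)) (hy : y ∈ Ioo (0 : ℝ) 1) :
    ‖(1 / √(1 - y) - 1) / (√y * √(x + (1 - x) * y))‖ ≤ 2 * ((1 / √(1 - y) - 1) / y) := by
  have hq := Real.sqrt_pos.2 (sub_pos.2 hy.2)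
  have h1 : 0 ≤ 1 / √(1 - y) - 1 := by
    rw [sub_nonneg, le_div_iff₀ hq, one_mul, Real.sqrt_le_one]
    linarith [hy.1]
  have h2 : √y / 2 ≤ √(x + (1 - x) * y) := by
    refine Real.le_sqrt_of_sq_le ?_
    rw [div_pow, Real.sq_sqrt hy.1.le]
    nlinarith [hx.1, hx.2, hy.1]
  have h3 := Real.sqrt_pos.2 hy.1
  have h4 : y / 2 ≤ √y * √(x + (1 - x) * y) := by
    nlinarith [Real.mul_self_sqrt hy.1.le]
  have h5 : 0 < y / 2 := half_pos hy.1
  rw [Real.norm_of_nonneg (div_nonneg h1 (h5.le.trans h4))]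
  calc _ ≤ (1 / √(1 - y) - 1) / (y / 2) := div_le_div_of_nonneg_left h1 h5 h4
    _ = _ := by have := hy.1.ne'; field_simp

lemma aestronglyMeasurable_remainder (x : ℝ) (μ : MeasureTheory.Measure ℝ) :
    MeasureTheory.AEStronglyMeasurable
      (fun y => (1 / √(1 - y) - 1) / (√y * √(x + (1 - x) * y))) μ := by
  apply Measurable.aestronglyMeasurable
  fun_prop

lemma tendsto_integral_remainder :
    Tendsto (fun x : ℝ => ∫ y in (0 : ℝ)..1, (1 / √(1 - y) - 1) / (√y * √(x + (1 - x) * y)))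
      (𝓝[>] 0) (𝓝 (2 * Real.log 2)) := by
  rw [← integral_inv_sqrt_one_sub_sub_one_div.2]
  refine intervalIntegral.tendsto_integral_filter_of_dominated_convergence
    (fun y => 2 * ((1 / √(1 - y) - 1) / y)) (.of_forall fun x => aestronglyMeasurable_remainder x _)
    ?_ (integral_inv_sqrt_one_sub_sub_one_div.1.const_mul 2) ?_
  · filter_upwards [Ioo_mem_nhdsGT (show (0 : ℝ) < 3 / 4 by norm_num)] with x hx
    filter_upwards [MeasureTheory.Measure.ae_ne MeasureTheory.volume (1 : ℝ)] with y hy1 hy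
    rw [uIoc_of_le zero_le_one] at hy
    exact remainder_bound hx ⟨hy.1, lt_of_le_of_ne hy.2 hy1⟩
  · refine .of_forall fun y hy => ?_
    rw [uIoc_of_le zero_le_one] at hy
    have h1 : Tendsto (fun x : ℝ => √y * √(x + (1 - x) * y)) (𝓝[>] 0)
        (𝓝 (√y * √(0 + (1 - 0) * y))) :=
      (Continuous.tendsto (by fun_prop) 0).mono_left nhdsWithin_le_nhds
    have h2 : √y * √(0 + (1 - 0) * y) = y := by simp [Real.mul_self_sqrt hy.1.le]
    rw [h2] at h1
    exact tendsto_const_nhds.div h1 hy.1.ne'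

/-- The logarithmic asymptotics of `varpi0` at `1`. -/
lemma tendsto_varpi0_one_sub :
    Tendsto (fun x : ℝ => varpi0 (1 - x) + 1 / (Real.pi : ℂ) *
      ((Real.log x - Real.log 16 : ℝ) : ℂ)) (𝓝[>] 0) (𝓝 0) := by
  have hsqrt : Tendsto (fun x : ℝ => √(1 - x)) (𝓝[>] 0) (𝓝 1) := by
    have : Tendsto (fun x : ℝ => √(1 - x)) (𝓝[>] 0) (𝓝 √(1 - 0)) :=
      (Continuous.tendsto (by fun_prop) 0).mono_left nhdsWithin_le_nhds
    simpa using this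
  have hlog : Tendsto (fun x : ℝ => Real.log x * x) (𝓝[>] 0) (𝓝 0) := by
    simpa using tendsto_log_mul_rpow_nhdsGT_zero zero_lt_one
  have h1 : Tendsto (fun x : ℝ => 1 / √(1 - x) * (2 * Real.log (1 + √(1 - x)))) (𝓝[>] 0)
      (𝓝 (2 * Real.log 2)) := by
    have := ((tendsto_const_nhds (x := (1 : ℝ))).div hsqrt one_ne_zero).mul
      (((hsqrt.const_add 1).log (by norm_num)).const_mul 2)
    norm_num at this
    simpa using this
  have h2 : Tendsto (fun x : ℝ => Real.log x * x * (-1 / (√(1 - x) * (1 + √(1 - x))))) (𝓝[>] 0)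
      (𝓝 0) := by
    have := hlog.mul ((tendsto_const_nhds (x := (-1 : ℝ))).div
      (hsqrt.mul (hsqrt.const_add 1)) (by norm_num))
    simpa using this
  have h3 : Tendsto (fun x : ℝ => 1 / Real.pi * (1 / √(1 - x) * (2 * Real.log (1 + √(1 - x))) +
      Real.log x * x * (-1 / (√(1 - x) * (1 + √(1 - x)))) +
      (∫ y in (0 : ℝ)..1, (1 / √(1 - y) - 1) / (√y * √(x + (1 - x) * y))) - Real.log 16))
      (𝓝[>] 0) (𝓝 0) := by
    have := (((h1.add h2).add tendsto_integral_remainder).sub_const (Real.log 16)).const_mul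
      (1 / Real.pi)
    convert this using 2
    rw [show (16 : ℝ) = 2 ^ 4 by norm_num, Real.log_pow]
    push_cast
    ring
  have h4 := (Complex.continuous_ofReal.tendsto _).comp h3
  rw [Complex.ofReal_zero] at h4
  refine h4.congr' ?_
  filter_upwards [Ioo_mem_nhdsGT (show (0 : ℝ) < 3 / 4 by norm_num)] with x hx
  have hx1 : x ∈ Ioo (0 : ℝ) 1 := ⟨hx.1, by linarith [hx.2]⟩
  have hrem : IntervalIntegrable (fun y => (1 / √(1 - y) - 1) / (√y * √(x + (1 - x) * y)))
      MeasureTheory.volume 0 1 := by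
    refine (integral_inv_sqrt_one_sub_sub_one_div.1.const_mul 2).mono_fun'
      (aestronglyMeasurable_remainder x _) ?_
    rw [Filter.EventuallyLE, MeasureTheory.ae_restrict_iff' measurableSet_uIoc]
    filter_upwards [MeasureTheory.Measure.ae_ne MeasureTheory.volume (1 : ℝ)] with y hy1 hy
    rw [uIoc_of_le zero_le_one] at hy
    exact remainder_bound hx ⟨hy.1, lt_of_le_of_ne hy.2 hy1⟩
  have hsplit : ∫ y in (0 : ℝ)..1, 1 / (√y * √(1 - y) * √(x + (1 - x) * y)) =
      (∫ y in (0 : ℝ)..1, 1 / (√y * √(x + (1 - x) * y))) +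
      ∫ y in (0 : ℝ)..1, (1 / √(1 - y) - 1) / (√y * √(x + (1 - x) * y)) := by
    rw [← intervalIntegral.integral_add (integral_inv_sqrt_mul_sqrt hx1).1 hrem]
    congr 1
    ext y
    simp only [div_eq_mul_inv, mul_inv]
    ring
  rw [varpi0_one_sub_ofReal hx1, hsplit, (integral_inv_sqrt_mul_sqrt hx1).2]
  rw [Function.comp_apply, show 1 / (Real.pi : ℂ) = ((1 / Real.pi : ℝ) : ℂ) by push_cast; rfl,
    ← Complex.ofReal_mul, ← Complex.ofReal_add]
  congr 1
  have hm : 0 < √(1 - x) := Real.sqrt_pos.2 (sub_pos.2 hx1.2)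
  have h5 : x = (1 - √(1 - x)) * (1 + √(1 - x)) := by
    nlinarith [Real.mul_self_sqrt (sub_pos.2 hx1.2).le]
  -- Replaces the coefficient 1/√(1 - x) of -log x by 1, at the cost of a multiple of x log x, which
  -- tends to 0.
  have h6 : x * (-1 / (√(1 - x) * (1 + √(1 - x)))) = 1 - 1 / √(1 - x) := by
    nth_rewrite 1 [h5]
    field_simp
    ring
  linear_combination (1 / Real.pi * Real.log x) * h6

/-! ### The Wronskian and the connection formula. -/

lemma ball_subset_oneSubSlit {r : ℝ} (hr : r ≤ 1) : ball (0 : ℂ) r ⊆ oneSubSlit := by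
  intro z hz
  have h1 : ‖-z‖ < 1 := by rw [norm_neg]; exact (mem_ball_zero_iff.1 hz).trans_le hr
  simpa [oneSubSlit, sub_eq_add_neg] using Complex.mem_slitPlane_of_norm_lt_one h1

lemma isPreconnected_ball_inter_slitPlane {r : ℝ} (hr : 0 < r) :
    IsPreconnected (ball (0 : ℂ) r ∩ Complex.slitPlane) := by
  have h1 : ((r / 2 : ℝ) : ℂ) ∈ ball (0 : ℂ) r := by
    rw [mem_ball_zero_iff, Complex.norm_real, Real.norm_of_nonneg (by positivity)]
    linarith
  have h2 : StarConvex ℝ ((r / 2 : ℝ) : ℂ) (ball (0 : ℂ) r ∩ Complex.slitPlane) :=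
    ((convex_ball _ _).starConvex h1).inter (Complex.starConvex_ofReal_slitPlane (half_pos hr))
  exact (h2.isPathConnected ⟨h1, Complex.ofReal_mem_slitPlane.2 (half_pos hr)⟩).isConnected.isPreconnected

/-- The Wronskian of `varpi0` and `varpi0 (1 - ·)`, multiplied by `lam (1 - lam)`. -/
def wronskian (lam : ℂ) : ℂ :=
  lam * (1 - lam) * (-(varpi0 lam * varpi0' (1 - lam)) - varpi0' lam * varpi0 (1 - lam))

lemma hasDerivAt_varpi0_one_sub {lam : ℂ} (h : lam ∈ Complex.slitPlane) :
    HasDerivAt (fun l => varpi0 (1 - l)) (-varpi0' (1 - lam)) lam := by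
  refine ((hasDerivAt_varpi0 (one_sub_mem_oneSubSlit h)).comp lam
      ((hasDerivAt_id lam).const_sub 1)).congr_deriv ?_
  ring

/-- The equation reads (lam (1 - lam) f')' = f / 4 and is invariant under lam ↦ 1 - lam, so both
functions solve it and Abel's identity applies. -/
lemma hasDerivAt_wronskian {lam : ℂ} (h : lam ∈ legendreDomain) :
    HasDerivAt wronskian 0 lam := by
  have h1 := hasDerivAt_varpi0 h.2
  have h2 := hasDerivAt_varpi0' h.2
  have h3 := hasDerivAt_varpi0_one_sub h.1
  have h4 : HasDerivAt (fun l => varpi0' (1 - l)) (-varpi0'' (1 - lam)) lam := by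
    refine ((hasDerivAt_varpi0' (one_sub_mem_oneSubSlit h.1)).comp lam
      ((hasDerivAt_id lam).const_sub 1)).congr_deriv ?_
    ring
  have h5 : HasDerivAt (fun l : ℂ => l * (1 - l)) (1 - 2 * lam) lam := by
    refine ((hasDerivAt_id lam).mul ((hasDerivAt_id lam).const_sub 1)).congr_deriv ?_
    simp only [id]
    ring
  refine (h5.mul ((h1.mul h4).neg.sub (h2.mul h3))).congr_deriv ?_
  have e1 := varpi0_ode h.2
  have e2 := varpi0_ode (one_sub_mem_oneSubSlit h.1)
  simp only [Pi.sub_apply, Pi.neg_apply, Pi.mul_apply]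
  linear_combination varpi0 lam * e2 - varpi0 (1 - lam) * e1

lemma differentiableOn_varpi0 : DifferentiableOn ℂ varpi0 oneSubSlit := fun _ h =>
  (hasDerivAt_varpi0 h).differentiableAt.differentiableWithinAt

lemma differentiableOn_varpi0' : DifferentiableOn ℂ varpi0' oneSubSlit := fun _ h =>
  (hasDerivAt_varpi0' h).differentiableAt.differentiableWithinAt

lemma zero_mem_oneSubSlit : (0 : ℂ) ∈ oneSubSlit := by simp [oneSubSlit]

lemma tendsto_ofReal_nhdsGT_zero :
    Tendsto (fun x : ℝ => (x : ℂ)) (𝓝[>] 0) (𝓝 0) := by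
  simpa using (Complex.continuous_ofReal.tendsto 0).mono_left nhdsWithin_le_nhds

/-- Since ϖ₀(x) - 1 = O(x), ϖ₀(x) log x may be replaced by log x in the limit that fixes the
constants. -/
lemma tendsto_varpi0_sub_one_mul_log :
    Tendsto (fun x : ℝ => (varpi0 x - 1) * (Real.log x : ℂ)) (𝓝[>] 0) (𝓝 0) := by
  have h1 : ContinuousAt (dslope varpi0 0) 0 :=
    continuousAt_dslope_same.2 (hasDerivAt_varpi0 zero_mem_oneSubSlit).differentiableAt
  have h2 := h1.tendsto.comp tendsto_ofReal_nhdsGT_zero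
  have h3 : Tendsto (fun x : ℝ => ((Real.log x * x : ℝ) : ℂ)) (𝓝[>] 0) (𝓝 0) := by
    have : Tendsto (fun x : ℝ => Real.log x * x) (𝓝[>] 0) (𝓝 0) := by
      simpa using tendsto_log_mul_rpow_nhdsGT_zero zero_lt_one
    have := (Complex.continuous_ofReal.tendsto 0).comp this
    rwa [Complex.ofReal_zero] at this
  have h4 := h2.mul h3
  rw [mul_zero] at h4
  refine h4.congr fun x => ?_
  have := sub_smul_dslope varpi0 0 (x : ℂ)
  rw [varpi0_zero, sub_zero, smul_eq_mul] at this
  rw [← this]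
  simp only [Function.comp_apply]
  push_cast
  ring

lemma eq_zero_of_tendsto_mul_log {A B : ℂ}
    (h : Tendsto (fun x : ℝ => A * (Real.log x : ℂ) + B) (𝓝[>] 0) (𝓝 0)) : A = 0 ∧ B = 0 := by
  have hA : A = 0 := by
    by_contra hA
    have h1 : Tendsto (fun x : ℝ => (Real.log x : ℂ)) (𝓝[>] 0) (𝓝 ((0 - B) / A)) := by
      refine ((h.sub_const B).div_const A).congr fun x => ?_
      field_simp
      ring
    have h2 := (Complex.continuous_re.tendsto _).comp h1
    exact not_tendsto_nhds_of_tendsto_atBot Real.tendsto_log_nhdsGT_zero _ h2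
  subst hA
  simp only [zero_mul, zero_add] at h
  exact ⟨rfl, tendsto_nhds_unique tendsto_const_nhds h⟩

/-- Near `0`, the period `varpi0 (1 - lam)` equals `-(1/π) varpi0(lam) (log lam + k(lam))` with `k`
holomorphic. -/
theorem exists_connection_formula : ∃ r : ℝ, 0 < r ∧ r ≤ 1 ∧
    (∀ lam ∈ ball (0 : ℂ) r, varpi0 lam ≠ 0 ∧ varpi0' lam ≠ 0) ∧
    ∃ k : ℂ → ℂ, k 0 = -(Real.log 16 : ℂ) ∧ DifferentiableOn ℂ k (ball 0 r) ∧
      ∀ lam ∈ ball (0 : ℂ) r ∩ Complex.slitPlane,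
        HasDerivAt (fun l => Complex.log l + k l) (1 / (lam * (1 - lam) * varpi0 lam ^ 2)) lam ∧
        (Real.pi : ℂ) * varpi0 (1 - lam) = -(varpi0 lam * (Complex.log lam + k lam)) := by
  have hU := isOpen_oneSubSlit.mem_nhds zero_mem_oneSubSlit
  have e1 : ∀ᶠ l in 𝓝 (0 : ℂ), varpi0 l ≠ 0 :=
    (hasDerivAt_varpi0 zero_mem_oneSubSlit).continuousAt.eventually_ne (by simp [varpi0_zero])
  have e2 : ∀ᶠ l in 𝓝 (0 : ℂ), varpi0' l ≠ 0 :=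
    (hasDerivAt_varpi0' zero_mem_oneSubSlit).continuousAt.eventually_ne (by simp [varpi0'_zero])
  obtain ⟨ε, hε, hball⟩ := Metric.eventually_nhds_iff_ball.1 (e1.and e2)
  have hr : 0 < min ε 1 := lt_min hε one_pos
  set r := min ε 1
  have hne : ∀ lam ∈ ball (0 : ℂ) r, varpi0 lam ≠ 0 ∧ varpi0' lam ≠ 0 := fun l hl =>
    hball l (ball_subset_ball (min_le_left _ _) hl)
  have hsub : ball (0 : ℂ) r ⊆ oneSubSlit := ball_subset_oneSubSlit (min_le_right _ _)
  refine ⟨r, hr, min_le_right _ _, hne, ?_⟩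
  have hone : ∀ l ∈ ball (0 : ℂ) r, 1 - l ≠ 0 := fun l hl => Complex.slitPlane_ne_zero (hsub hl)
  set q : ℂ → ℂ := fun l => 1 / ((1 - l) * varpi0 l ^ 2)
  have hq : DifferentiableOn ℂ q (ball 0 r) := by
    refine (differentiableOn_const 1).div (DifferentiableOn.mul (by fun_prop)
      ((differentiableOn_varpi0.mono hsub).pow 2)) fun l hl => ?_
    exact mul_ne_zero (hone l hl) (pow_ne_zero 2 (hne l hl).1)
  have hq0 : q 0 = 1 := by simp [q, varpi0_zero]
  have hdq := (Complex.differentiableOn_dslope (c := 0) (ball_mem_nhds 0 hr)).2 hq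
  -- As q(0) = 1, q(l)/l is 1/l plus a holomorphic function, and k is a primitive of the latter. The
  -- normalisation -log 16 is the one that makes the additive constant c below vanish.
  obtain ⟨k, hk0, hk⟩ := hdq.isExactOn_ball.with_val_at 0 (-(Real.log 16 : ℂ))
  have hkd : DifferentiableOn ℂ k (ball 0 r) := fun l hl =>
    (hk l hl).differentiableAt.differentiableWithinAt
  refine ⟨k, hk0, hkd, ?_⟩
  set S := ball (0 : ℂ) r ∩ Complex.slitPlane
  have hSo : IsOpen S := isOpen_ball.inter Complex.isOpen_slitPlane
  have hSp : IsPreconnected S := isPreconnected_ball_inter_slitPlane hr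
  have hSL : S ⊆ legendreDomain := fun l hl => ⟨hl.2, hsub hl.1⟩
  have hlogk : ∀ l ∈ S, HasDerivAt (fun l => Complex.log l + k l)
      (1 / (l * (1 - l) * varpi0 l ^ 2)) l := fun l hl => by
    refine ((Complex.hasDerivAt_log hl.2).add (hk l hl.1)).congr_deriv ?_
    have hl0 := Complex.slitPlane_ne_zero hl.2
    rw [dslope_of_ne _ hl0, slope_def_field, hq0]
    have h1 := hone l hl.1
    have h2 := (hne l hl.1).1
    simp only [q]
    field_simp
    ring
  obtain ⟨κ, hκ⟩ := hSo.exists_is_const_of_deriv_eq_zero hSp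
    (fun l hl => (hasDerivAt_wronskian (hSL hl)).differentiableAt.differentiableWithinAt)
    (fun l hl => (hasDerivAt_wronskian (hSL hl)).deriv)
  -- The quotient of the two solutions has derivative κ / (l (1 - l) ϖ₀²), which is κ times the
  -- derivative of log l + k.
  have hV : ∀ l ∈ S, HasDerivAt (fun l => varpi0 (1 - l) / varpi0 l - κ * (Complex.log l + k l))
      0 l := fun l hl => by
    have hl0 := Complex.slitPlane_ne_zero hl.2
    have h1 := hone l hl.1
    have h2 := (hne l hl.1).1
    refine (((hasDerivAt_varpi0_one_sub hl.2).div (hasDerivAt_varpi0 (hsub hl.1)) h2).sub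
      ((hlogk l hl).const_mul κ)).congr_deriv ?_
    rw [← hκ l hl, wronskian]
    field_simp
    ring
  obtain ⟨c, hc⟩ := hSo.exists_is_const_of_deriv_eq_zero hSp
    (fun l hl => (hV l hl).differentiableAt.differentiableWithinAt)
    (fun l hl => (hV l hl).deriv)
  have hg : ∀ l ∈ S, varpi0 (1 - l) = varpi0 l * (κ * (Complex.log l + k l) + c) := fun l hl => by
    have h2 := (hne l hl.1).1
    rw [← hc l hl]
    field_simp
    ring
  have hpi : (Real.pi : ℂ) ≠ 0 := by exact_mod_cast Real.pi_ne_zero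
  have hf0 : Tendsto (fun x : ℝ => varpi0 x) (𝓝[>] 0) (𝓝 1) := by
    have := (hasDerivAt_varpi0 zero_mem_oneSubSlit).continuousAt.tendsto.comp
      tendsto_ofReal_nhdsGT_zero
    rwa [varpi0_zero] at this
  have hkt : Tendsto (fun x : ℝ => k x) (𝓝[>] 0) (𝓝 (-(Real.log 16 : ℂ))) := by
    have := (hk 0 (mem_ball_self hr)).continuousAt.tendsto.comp tendsto_ofReal_nhdsGT_zero
    rwa [hk0] at this
  -- The form of ϖ₀(1 - x) just found, compared with its real asymptotics: both coefficients must
  -- vanish because log is unbounded at 0.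
  have hlim : Tendsto (fun x : ℝ => (κ + 1 / (Real.pi : ℂ)) * (Real.log x : ℂ) +
      (κ * -(Real.log 16 : ℂ) + c - 1 / (Real.pi : ℂ) * Real.log 16)) (𝓝[>] 0) (𝓝 0) := by
    have h1 := (tendsto_varpi0_one_sub.sub (tendsto_varpi0_sub_one_mul_log.const_mul κ)).add
      ((hf0.mul ((hkt.const_mul κ).add_const c)).neg.add_const (κ * -(Real.log 16 : ℂ) + c))
    rw [mul_zero, one_mul, neg_add_cancel, sub_zero, zero_add] at h1
    refine h1.congr' ?_
    filter_upwards [Ioo_mem_nhdsGT hr] with x hx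
    have hxS : (x : ℂ) ∈ S := by
      refine ⟨?_, Complex.ofReal_mem_slitPlane.2 hx.1⟩
      rw [mem_ball_zero_iff, Complex.norm_real, Real.norm_of_nonneg hx.1.le]
      exact hx.2
    rw [hg x hxS, Complex.ofReal_log hx.1.le]
    push_cast
    rw [Complex.ofReal_log hx.1.le]
    ring
  obtain ⟨hA, hB⟩ := eq_zero_of_tendsto_mul_log hlim
  have hκ' : κ = -(1 / (Real.pi : ℂ)) := by linear_combination hA
  have hc' : c = 0 := by
    rw [hκ'] at hB
    linear_combination hB
  intro l hl
  refine ⟨hlogk l hl, ?_⟩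
  rw [hg l hl, hκ', hc']
  field_simp
  ring

/-! ### The logarithmic structure of φ near 0. -/

/-- The regular part `1 / ((1 - lam) ϖ₀ ϖ₀')` of the period ratio. -/
def ratioPart (lam : ℂ) : ℂ := 1 / ((1 - lam) * varpi0 lam * varpi0' lam)

lemma ratioPart_zero : ratioPart 0 = 4 := by
  simp [ratioPart, varpi0_zero, varpi0'_zero]

/-- The origin of the factor exp(-3/2) in F; it needs the Taylor coefficients of `varpi0` up to
second order. -/
lemma hasDerivAt_ratioPart_zero : HasDerivAt ratioPart (-3 / 2) 0 := by
  have h0 := zero_mem_oneSubSlit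
  have h := ((((hasDerivAt_id (0 : ℂ)).const_sub 1).mul (hasDerivAt_varpi0 h0)).mul
    (hasDerivAt_varpi0' h0)).inv (by simp [varpi0_zero, varpi0'_zero])
  have e : ratioPart = (((fun x : ℂ => 1 - id x) * varpi0) * varpi0')⁻¹ := by
    ext l
    simp [ratioPart]
  rw [e]
  refine h.congr_deriv ?_
  simp [varpi0_zero, varpi0'_zero, varpi0''_zero]
  norm_num

/-- Near `0`, `π i φ = log lam + m(lam) + 4 / lam` with `m` holomorphic. -/
theorem exists_log_structure : ∃ r : ℝ, 0 < r ∧ r ≤ 1 ∧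
    (∀ lam ∈ ball (0 : ℂ) r, varpi0' lam ≠ 0) ∧
    ∃ m : ℂ → ℂ, DifferentiableOn ℂ m (ball 0 r) ∧ m 0 = -(Real.log 16 : ℂ) - 3 / 2 ∧
      ∀ lam ∈ ball (0 : ℂ) r ∩ Complex.slitPlane,
        (Real.pi : ℂ) * Complex.I * (bpsPeriods lam).2 =
          (bpsPeriods lam).1 * (Complex.log lam + (m lam + 4 / lam)) := by
  obtain ⟨r, hr, hr1, hne, k, hk0, hk, hconn⟩ := exists_connection_formula
  have hsub : ball (0 : ℂ) r ⊆ oneSubSlit := ball_subset_oneSubSlit hr1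
  have hX : DifferentiableOn ℂ ratioPart (ball 0 r) := by
    refine (differentiableOn_const 1).div (DifferentiableOn.mul (DifferentiableOn.mul (by fun_prop)
      (differentiableOn_varpi0.mono hsub)) (differentiableOn_varpi0'.mono hsub)) fun l hl => ?_
    exact mul_ne_zero (mul_ne_zero (Complex.slitPlane_ne_zero (hsub hl)) (hne l hl).1) (hne l hl).2
  refine ⟨r, hr, hr1, fun l hl => (hne l hl).2, fun l => k l + dslope ratioPart 0 l,
    hk.add ((Complex.differentiableOn_dslope (ball_mem_nhds 0 hr)).2 hX), ?_, ?_⟩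
  · change k 0 + dslope ratioPart 0 0 = _
    rw [hk0, dslope_same, hasDerivAt_ratioPart_zero.deriv]
    ring
  intro l hl
  have hl0 := Complex.slitPlane_ne_zero hl.2
  have hL : l ∈ legendreDomain := ⟨hl.2, hsub hl.1⟩
  have h1 : 1 - l ≠ 0 := Complex.slitPlane_ne_zero (hsub hl.1)
  obtain ⟨h2, h3⟩ := hne l hl.1
  have hopen : ball (0 : ℂ) r ∩ Complex.slitPlane ∈ 𝓝 l :=
    (isOpen_ball.inter Complex.isOpen_slitPlane).mem_nhds hl
  have hd1 : HasDerivAt (fun l => (Real.pi : ℂ) * varpi0 (1 - l))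
      ((Real.pi : ℂ) * -varpi0' (1 - l)) l :=
    (hasDerivAt_varpi0_one_sub hl.2).const_mul _
  -- Differentiating the connection formula: the derivative of log l + k contributes, after division
  -- by ϖ₀', the term `ratioPart l / l`, whose polar part is 4 / l.
  have hd2 := (((hasDerivAt_varpi0 (hsub hl.1)).mul (hconn l hl).1).neg).congr_of_eventuallyEq
    (f₁ := fun l => (Real.pi : ℂ) * varpi0 (1 - l)) (by
      filter_upwards [hopen] with z hz using (hconn z hz).2)
  have hd := hd1.unique hd2
  dsimp only
  rw [bpsPeriods_eq hL, dslope_of_ne _ hl0, slope_def_field, ratioPart_zero, ratioPart]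
  simp only [sub_zero]
  have hpi : (Real.pi : ℂ) * varpi0' (1 - l) = varpi0' l * (Complex.log l + k l) +
      varpi0 l * (1 / (l * (1 - l) * varpi0 l ^ 2)) := by linear_combination -hd
  calc (Real.pi : ℂ) * Complex.I * (-Complex.I * (4 * l * (l - 1) * varpi0' (1 - l)))
      = 4 * l * (l - 1) * ((Real.pi : ℂ) * varpi0' (1 - l)) := by
        linear_combination (-(Real.pi : ℂ) * (4 * l * (l - 1) * varpi0' (1 - l))) * Complex.I_sq
    _ = _ := by
        rw [hpi]
        field_simp
        ring

/-! ### Value distribution near the essential singularity. -/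

lemma norm_log_le_of_one_le {w : ℂ} {R : ℝ} (h1 : 1 ≤ ‖w‖) (h2 : ‖w‖ ≤ R) :
    ‖Complex.log w‖ ≤ Real.log R + Real.pi := by
  refine (Complex.norm_le_abs_re_add_abs_im _).trans (add_le_add ?_ ?_)
  · rw [Complex.log_re, abs_of_nonneg (Real.log_nonneg h1)]
    exact Real.log_le_log (by linarith) h2
  · rw [Complex.log_im]
    exact Complex.abs_arg_le_pi w

lemma eventually_log_lt (K : ℝ) :
    ∀ᶠ n : ℝ in atTop, Real.log (3 * n) + Real.pi + K < n := by
  have h1 : Tendsto (fun n : ℝ => Real.log n / n) atTop (𝓝 0) := by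
    simpa using Real.tendsto_pow_log_div_mul_add_atTop 1 0 1 one_ne_zero
  filter_upwards [h1.eventually_lt_const (show (0 : ℝ) < 1 / 2 by norm_num), eventually_gt_atTop 0,
    eventually_gt_atTop (2 * (Real.log 3 + Real.pi + K))] with n hn hpos hK
  rw [Real.log_mul (by norm_num) hpos.ne']
  rw [div_lt_iff₀ hpos] at hn
  linarith

/-- A function `4 w - log w + b(w)` with `b` bounded takes, high up in the upper half-plane, all
values of an arithmetic progression with difference `2 π i`, from some point on. -/
lemma eventually_exists_sub_log_eq {b : ℂ → ℂ} {K R : ℝ} (hR : 1 ≤ R)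
    (hb : ∀ w : ℂ, R < ‖w‖ → DifferentiableAt ℂ b w ∧ ‖b w‖ ≤ K) (C : ℂ) :
    ∀ᶠ n : ℝ in atTop, ∃ w : ℂ, R < ‖w‖ ∧ w ∈ Complex.slitPlane ∧
      4 * w - Complex.log w + b w = 2 * Real.pi * n * Complex.I + C := by
  filter_upwards [eventually_log_lt (K + ‖C‖ + 1), eventually_gt_atTop (2 * R)] with n hn hnR
  have hn0 : 0 < n := by linarith
  set H : Set ℂ := {w | n / 2 < w.im}
  have hHo : IsOpen H := isOpen_lt continuous_const Complex.continuous_im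
  have hHc : Convex ℝ H := convex_halfSpace_im_gt _
  have hHR : ∀ w ∈ H, R < ‖w‖ := fun w hw => by
    have h1 : n / 2 < w.im := hw
    have h2 := (le_abs_self w.im).trans (Complex.abs_im_le_norm w)
    linarith
  have hHs : ∀ w ∈ H, w ∈ Complex.slitPlane := fun w hw => by
    have h1 : n / 2 < w.im := hw
    exact Or.inr (by linarith)
  set f : ℂ → ℂ := fun w => 4 * w - Complex.log w + b w
  have hf : DifferentiableOn ℂ f H := fun w hw =>
    ((((differentiableAt_id.const_mul (4 : ℂ)).sub (Complex.differentiableAt_log (hHs w hw))).add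
      (hb w (hHR w hw)).1)).differentiableWithinAt
  -- The root of 4 w = 2 π i n. The disc of radius n about it lies in Im w > n/2 because π/2 - 1 >
  -- 1/2, and in |w| ≤ 3 n because π/2 + 1 < 3.
  set w₀ : ℂ := ((Real.pi / 2 * n : ℝ) : ℂ) * Complex.I
  have hw₀im : w₀.im = Real.pi / 2 * n := by simp [w₀]
  have hw₀n : ‖w₀‖ = Real.pi / 2 * n := by
    rw [norm_mul, Complex.norm_I, mul_one, Complex.norm_real, Real.norm_of_nonneg (by positivity)]
  have hsub : closedBall w₀ n ⊆ H := fun w hw => by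
    rw [mem_closedBall, dist_eq_norm] at hw
    have h1 := (abs_le.1 ((Complex.abs_im_le_norm (w - w₀)).trans hw)).1
    rw [Complex.sub_im, hw₀im] at h1
    change n / 2 < w.im
    nlinarith [Real.pi_gt_d2]
  have hcb : ∀ w ∈ closedBall w₀ n, ‖w‖ ≤ 3 * n := fun w hw => by
    rw [mem_closedBall, dist_eq_norm] at hw
    have h1 := norm_le_norm_add_norm_sub' w w₀
    nlinarith [Real.pi_lt_d2]
  have herr : ∀ w ∈ closedBall w₀ n, ‖f w - 4 * w‖ ≤ Real.log (3 * n) + Real.pi + K :=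
    fun w hw => by
    have h1 := hHR w (hsub hw)
    have h2 := norm_log_le_of_one_le (hR.trans h1.le) (hcb w hw)
    have h3 := (hb w h1).2
    calc ‖f w - 4 * w‖ = ‖b w - Complex.log w‖ := by congr 1; simp only [f]; ring
      _ ≤ ‖b w‖ + ‖Complex.log w‖ := norm_sub_le _ _
      _ ≤ _ := by linarith
  set E := Real.log (3 * n) + Real.pi + K
  have hw₀ : w₀ ∈ closedBall w₀ n := mem_closedBall_self hn0.le
  have hsphere : ∀ w ∈ sphere w₀ n, 4 * n - 2 * E ≤ ‖f w - f w₀‖ := fun w hw => by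
    have h1 := herr w (sphere_subset_closedBall hw)
    have h2 := herr w₀ hw₀
    have h3 : ‖4 * (w - w₀)‖ = 4 * n := by
      rw [norm_mul, ← dist_eq_norm, mem_sphere.1 hw]
      norm_num
    have h4 : 4 * (w - w₀) = (f w - f w₀) - ((f w - 4 * w) - (f w₀ - 4 * w₀)) := by ring
    have h5 := norm_sub_le (f w - f w₀) ((f w - 4 * w) - (f w₀ - 4 * w₀))
    have h6 := norm_sub_le (f w - 4 * w) (f w₀ - 4 * w₀)
    rw [← h4, h3] at h5
    linarith
  have hC0 := norm_nonneg C
  have hfreq : ∃ᶠ z in 𝓝 w₀, f z ≠ f w₀ := by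
    intro hev
    simp only [ne_eq, not_not] at hev
    have han : AnalyticOnNhd ℂ f H := hf.analyticOnNhd hHo
    have heq := han.eqOn_of_preconnected_of_eventuallyEq (g := fun _ => f w₀)
      analyticOnNhd_const hHc.isPreconnected (hsub hw₀) hev
    have hmem : w₀ + n ∈ sphere w₀ n := by simp [hn0.le]
    have h1 := hsphere _ hmem
    rw [heq (hsub (sphere_subset_closedBall hmem)), sub_self, norm_zero] at h1
    linarith
  -- Quantitative open mapping: the image covers the disc of radius 2 n - E about `f w₀`, whereas
  -- the target is within ‖C‖ + E of `f w₀` and E = O(log n).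
  have himg := (hf.diffContOnCl_ball hsub).ball_subset_image_closedBall hn0 hsphere hfreq
  have htarget : 2 * Real.pi * n * Complex.I + C ∈ ball (f w₀) ((4 * n - 2 * E) / 2) := by
    rw [mem_ball, dist_eq_norm]
    have h2 := herr w₀ hw₀
    have h4 : 2 * Real.pi * n * Complex.I + C - f w₀ = C - (f w₀ - 4 * w₀) := by
      simp only [w₀]
      push_cast
      ring
    rw [h4]
    have := norm_sub_le C (f w₀ - 4 * w₀)
    linarith
  obtain ⟨w, hw, hfw⟩ := himg htarget
  exact ⟨w, hHR w (hsub hw), hHs w (hsub hw), hfw⟩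

/-- If `m` is holomorphic near `0` then `lam exp (m(lam) + 4 / lam)` takes every nonzero value in
every punctured neighbourhood of `0`. -/
lemma exists_mul_exp_add_div_eq {m : ℂ → ℂ} {r : ℝ} (hr : 0 < r)
    (hm : DifferentiableOn ℂ m (ball 0 r)) {c : ℂ} (hc : c ≠ 0) {N : Set ℂ} (hN : N ∈ 𝓝 (0 : ℂ)) :
    ∃ lam ∈ N \ {0}, 16 * lam * Complex.exp (m lam + 4 / lam) = c := by
  have hcont : ContinuousAt m 0 := (hm.differentiableAt (ball_mem_nhds 0 hr)).continuousAt
  have hev : ∀ᶠ z in 𝓝 (0 : ℂ), ‖m z‖ < ‖m 0‖ + 1 :=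
    hcont.norm.eventually_lt_const (by linarith)
  obtain ⟨δ, hδ, hball⟩ := Metric.eventually_nhds_iff_ball.1
    ((hev.and (ball_mem_nhds (0 : ℂ) hr)).and hN)
  have hinv : ∀ w : ℂ, max 1 δ⁻¹ < ‖w‖ → w ≠ 0 ∧ w⁻¹ ∈ ball (0 : ℂ) δ := fun w hw => by
    have h1 : 0 < ‖w‖ := one_pos.trans ((le_max_left _ _).trans_lt hw)
    refine ⟨norm_pos_iff.1 h1, ?_⟩
    rw [mem_ball_zero_iff, norm_inv]
    exact inv_lt_of_inv_lt₀ hδ ((le_max_right _ _).trans_lt hw)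
  obtain ⟨C, hC⟩ : ∃ C, Complex.exp C = c / 16 := ⟨_, Complex.exp_log (by simpa using hc)⟩
  have hb : ∀ w : ℂ, max 1 δ⁻¹ < ‖w‖ →
      DifferentiableAt ℂ (fun w => m w⁻¹) w ∧ ‖m w⁻¹‖ ≤ ‖m 0‖ + 1 := fun w hw => by
    obtain ⟨hw0, hwb⟩ := hinv w hw
    have h1 := (hball _ hwb).1
    exact ⟨(hm.differentiableAt (isOpen_ball.mem_nhds h1.2)).fun_comp' w (differentiableAt_inv hw0),
      h1.1.le⟩
  -- Only for an integer n does the exponential remove 2 π i n.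
  obtain ⟨n, w, hwR, hws, hw⟩ := (tendsto_natCast_atTop_atTop.eventually
    (eventually_exists_sub_log_eq (le_max_left 1 δ⁻¹) hb C)).exists
  obtain ⟨hw0, hwb⟩ := hinv w hwR
  refine ⟨w⁻¹, ⟨(hball _ hwb).2, inv_ne_zero hw0⟩, ?_⟩
  have h1 : Complex.exp (4 * w - Complex.log w + m w⁻¹) = c / 16 := by
    rw [hw, Complex.exp_add, hC]
    have : (2 * Real.pi * ((n : ℝ) : ℂ) * Complex.I) = n * (2 * Real.pi * Complex.I) := by
      push_cast; ring
    rw [this, Complex.exp_nat_mul_two_pi_mul_I, one_mul]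
  rw [sub_add_eq_add_sub, Complex.exp_sub, Complex.exp_log hw0] at h1
  rw [div_inv_eq_mul, add_comm]
  linear_combination 16 * h1

lemma infinite_of_forall_nhds {A : Set ℂ} {z₀ : ℂ} (h0 : z₀ ∉ A)
    (h : ∀ N ∈ 𝓝 z₀, (N ∩ A).Nonempty) : A.Infinite := fun hfin => by
  obtain ⟨z, hz1, hz2⟩ := h _ (hfin.isClosed.isOpen_compl.mem_nhds h0)
  exact hz1 hz2

/-- A meromorphic germ has a limit, finite or infinite. A pole excludes the value 1 nearby, and a
finite limit cannot equal both 1 and 2. -/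
lemma not_meromorphicAt_of_values {G : ℂ → ℂ} {z₀ : ℂ}
    (h : ∀ c : ℂ, c ≠ 0 → ∃ᶠ z in 𝓝[≠] z₀, G z = c) : ¬ MeromorphicAt G z₀ := fun hG => by
  rcases lt_or_ge (meromorphicOrderAt G z₀) 0 with ho | ho
  · have h1 := tendsto_cobounded_of_meromorphicOrderAt_neg ho
    have h2 := (tendsto_norm_cobounded_atTop.comp h1).eventually_gt_atTop 1
    obtain ⟨z, hz1, hz2⟩ := ((h 1 one_ne_zero).and_eventually h2).exists
    simp [hz1] at hz2
  · obtain ⟨c, hc⟩ := tendsto_nhds_of_meromorphicOrderAt_nonneg hG ho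
    have key : ∀ d : ℂ, d ≠ 0 → d = c := fun d hd => by
      by_contra hdc
      obtain ⟨z, hz1, hz2⟩ := ((h d hd).and_eventually (hc.eventually_ne (Ne.symm hdc))).exists
      exact hz2 hz1
    exact one_ne_zero (by linear_combination key 2 two_ne_zero - key 1 one_ne_zero)

/-! ### Branches and analytic continuation. -/

/-- Permanence of analytic relations under analytic continuation. -/
lemma IsBranchAt.relation {f : ℂ → ℂ × ℂ} {U D : Set ℂ} {z : ℂ} {g : ℂ → ℂ × ℂ}
    (h : IsBranchAt f U D z g) (hU : IsOpen (U ∩ D)) {R : ℂ → ℂ × ℂ → ℂ}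
    (hR : ∀ w ∈ D, ∀ G : ℂ → ℂ × ℂ, AnalyticAt ℂ G w → AnalyticAt ℂ (fun z => R z (G z)) w)
    (hf : ∀ w ∈ U ∩ D, R w (f w) = 0) : R z (g z) = 0 := by
  obtain ⟨z₀, hz₀, γ, hγ, G, hG, hloc, hG0, hG1⟩ := h
  -- The parameters at which the relation holds as an identity of germs; this set is clopen in [0,
  -- 1].
  set T : Set unitInterval := {t | ∀ᶠ z in 𝓝 (γ t), R z (G t z) = 0}
  have hcompat : ∀ t, ∀ᶠ s in 𝓝 t, (s ∈ T ↔ ∀ᶠ z in 𝓝 (γ s), R z (G t z) = 0) := fun t => by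
    filter_upwards [hloc t] with s hs
    refine eventually_congr ?_
    filter_upwards [hs] with z hz
    rw [hz]
  have hopen : IsOpen T := by
    refine isOpen_iff_eventually.2 fun t ht => ?_
    filter_upwards [hcompat t, γ.continuous.continuousAt.eventually
      (eventually_eventually_nhds.2 ht)] with s hs h1 using hs.2 h1
  have hclosed : IsOpen Tᶜ := by
    refine isOpen_iff_eventually.2 fun t ht => ?_
    -- By isolation of zeros, a germ that is not identically zero has no zero nearby except possibly
    -- at γ t itself. Density of the complement of γ t covers the case γ s = γ t.
    rcases (hR _ (hγ t) _ (hG t)).eventually_eq_zero_or_eventually_ne_zero with h0 | h0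
    · exact absurd h0 ht
    have h1 := eventually_eventually_nhds.2 (eventually_nhdsWithin_iff.1 h0)
    filter_upwards [hcompat t, γ.continuous.continuousAt.eventually h1] with s hs h2 hsT
    have h3 := mem_closure_iff_frequently.1 (dense_compl_singleton (γ t) (γ s))
    obtain ⟨w, hw, hw1, hw2⟩ := (h3.and_eventually (h2.and (hs.1 hsT))).exists
    exact hw1 hw hw2
  have h0 : (0 : unitInterval) ∈ T := by
    change ∀ᶠ z in 𝓝 (γ 0), R z (G 0 z) = 0
    have hmem : γ 0 ∈ U ∩ D := ⟨by rwa [γ.source], hγ 0⟩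
    have hG0' : G 0 =ᶠ[𝓝 (γ 0)] f := by rwa [γ.source]
    filter_upwards [hU.mem_nhds hmem, hG0'] with w hw hw'
    rw [hw']
    exact hf w hw
  have hT : T = univ := IsClopen.eq_univ ⟨⟨hclosed⟩, hopen⟩ ⟨0, h0⟩
  have h1 : (1 : unitInterval) ∈ T := by rw [hT]; exact mem_univ _
  change ∀ᶠ z in 𝓝 (γ 1), R z (G 1 z) = 0 at h1
  rw [γ.target] at h1
  rw [← hG1.self_of_nhds]
  exact h1.self_of_nhds

/-- Branches are transported by a change of the variable and a linear map of the values. -/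
lemma IsBranchAt.transport {f f' : ℂ → ℂ × ℂ} {U U' D D' : Set ℂ} {z : ℂ} {g : ℂ → ℂ × ℂ}
    (h : IsBranchAt f U D z g) (hU : IsOpen U) {ψ φ : ℂ → ℂ} (hψ : Continuous ψ)
    (hφ : Differentiable ℂ φ) (hφψ : ∀ w, φ (ψ w) = w) (hψφ : ∀ w, ψ (φ w) = w)
    (M : ℂ × ℂ →L[ℂ] ℂ × ℂ) (hf : ∀ w ∈ U, f' (ψ w) = M (f w)) (hUU' : ∀ w ∈ U, ψ w ∈ U')
    (hDD' : ∀ w ∈ D, ψ w ∈ D') :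
    IsBranchAt f' U' D' (ψ z) (fun w => M (g (φ w))) := by
  obtain ⟨z₀, hz₀, γ, hγ, G, hG, hloc, hG0, hG1⟩ := h
  have hev : ∀ {p : ℂ → Prop} {w : ℂ}, (∀ᶠ x in 𝓝 w, p x) → ∀ᶠ x in 𝓝 (ψ w), p (φ x) := by
    intro p w hp
    have := hφ.continuous.continuousAt (x := ψ w)
    rw [ContinuousAt, hφψ] at this
    exact this.eventually hp
  refine ⟨ψ z₀, hUU' _ hz₀, γ.map hψ, fun t => hDD' _ (hγ t), fun t w => M (G t (φ w)), ?_, ?_,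
    ?_, ?_⟩
  · intro t
    have h1 : AnalyticAt ℂ (G t) (φ (ψ (γ t))) := by rw [hφψ]; exact hG t
    exact (M.analyticAt _).comp (h1.comp (hφ.analyticAt _))
  · intro t
    filter_upwards [hloc t] with s hs
    have := hev hs
    change ∀ᶠ x in 𝓝 (ψ (γ s)), _
    filter_upwards [this] with x hx
    rw [hx]
  · filter_upwards [hev hG0, hev (hU.mem_nhds hz₀)] with x hx hxU
    rw [hx, ← hf _ hxU, hψφ]
  · filter_upwards [hev hG1] with x hx
    rw [hx]

lemma image_quotientFiber_subset {f f' : ℂ → ℂ × ℂ} {U U' D D' : Set ℂ} (hU : IsOpen U)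
    {ψ φ : ℂ → ℂ} (hψ : Continuous ψ)
    (hφ : Differentiable ℂ φ) (hφψ : ∀ w, φ (ψ w) = w) (hψφ : ∀ w, ψ (φ w) = w)
    (M : ℂ × ℂ →L[ℂ] ℂ × ℂ) (hf : ∀ w ∈ U, f' (ψ w) = M (f w)) (hUU' : ∀ w ∈ U, ψ w ∈ U')
    (hDD' : ∀ w ∈ D, ψ w ∈ D') {s t : ℂ}
    (hst : ∀ p : ℂ × ℂ, p.1 ≠ 0 → p.2 / p.1 = s → (M p).1 ≠ 0 ∧ (M p).2 / (M p).1 = t) :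
    ψ '' quotientFiber f U D s ⊆ quotientFiber f' U' D' t := by
  rintro _ ⟨z, ⟨hzD, g, hg, hg1, hg2⟩, rfl⟩
  refine ⟨hDD' z hzD, _, hg.transport hU hψ hφ hφψ hψφ M hf hUU' hDD', ?_⟩
  simp only [hφψ]
  exact hst _ hg1 hg2

/-- The two arguments sum to less than π in absolute value, so no branch jump occurs. This makes
neighbouring germs along a circle agree. -/
lemma log_mul_exp_add {v : ℂ} (hv : 0 < v.re) {δ : ℝ} (hδ : |δ| < Real.pi / 2) :
    Complex.log (v * Complex.exp (δ * Complex.I)) = Complex.log v + δ * Complex.I := by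
  have hv0 : v ≠ 0 := by rintro rfl; simp at hv
  have h1 := abs_lt.1 (Complex.abs_arg_lt_pi_div_two_iff.2 (Or.inl hv))
  have h2 := abs_lt.1 hδ
  have him : (Complex.log v + δ * Complex.I).im = v.arg + δ := by simp [Complex.log_im]
  rw [← Complex.log_exp (x := Complex.log v + δ * Complex.I) (by rw [him]; linarith)
    (by rw [him]; linarith), Complex.exp_add, Complex.exp_log hv0]

section Branches

variable {r : ℝ} {m : ℂ → ℂ}

/-- Near `0`, every logarithm of `z` gives rise to a branch of the BPS periods at `z`. -/
lemma exists_isBranchAt (hr1 : r ≤ 1) (hm : DifferentiableOn ℂ m (ball 0 r))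
    (hlog : ∀ lam ∈ ball (0 : ℂ) r ∩ Complex.slitPlane,
        (Real.pi : ℂ) * Complex.I * (bpsPeriods lam).2 =
          (bpsPeriods lam).1 * (Complex.log lam + (m lam + 4 / lam)))
    {D : Set ℂ} {L : ℂ} (hLr : ‖Complex.exp L‖ < r) (hD : sphere (0 : ℂ) ‖Complex.exp L‖ ⊆ D) :
    ∃ g, IsBranchAt bpsPeriods legendreDomain D (Complex.exp L) g ∧
      g (Complex.exp L) = (4 * Complex.exp L * (Complex.exp L - 1) * varpi0' (Complex.exp L),
        4 * Complex.exp L * (Complex.exp L - 1) * varpi0' (Complex.exp L) *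
          (L + (m (Complex.exp L) + 4 / Complex.exp L)) / (Real.pi * Complex.I)) := by
  set z := Complex.exp L
  have hz0 : z ≠ 0 := Complex.exp_ne_zero L
  have hpi : (Real.pi : ℂ) * Complex.I ≠ 0 :=
    mul_ne_zero (by exact_mod_cast Real.pi_ne_zero) Complex.I_ne_zero
  have hsub : ball (0 : ℂ) r ⊆ oneSubSlit := ball_subset_oneSubSlit hr1
  set α := L.im
  -- The path `c` follows the circle from exp(Re L) > 0 to exp L, with winding prescribed by Im L.
  -- The factor `rot t` turns `c t` back to the positive axis, where the principal logarithm is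
  -- analytic, and `Γ` adds the angle α t back.
  set rot : ℝ → ℂ := fun t => Complex.exp (-((α * t : ℝ) : ℂ) * Complex.I)
  set c : ℝ → ℂ := fun t => Complex.exp ((L.re : ℂ) + ((α * t : ℝ) : ℂ) * Complex.I)
  have hc : Continuous c := by fun_prop
  have hcn : ∀ t, ‖c t‖ = ‖z‖ := fun t => by simp [c, z, Complex.norm_exp]
  have hcr : ∀ t, c t ∈ ball (0 : ℂ) r := fun t => by rw [mem_ball_zero_iff, hcn]; exact hLr
  have hrot : ∀ t, c t * rot t = Complex.exp L.re := fun t => by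
    rw [← Complex.exp_add]
    congr 1
    ring
  have hre : (0 : ℝ) < (Complex.exp L.re).re := by
    rw [← Complex.ofReal_exp, Complex.ofReal_re]
    exact Real.exp_pos _
  have hc0 : c 0 = Complex.exp L.re := by simp [c]
  have hc1 : c 1 = z := by
    simp only [c, z, mul_one, α]
    rw [Complex.re_add_im]
  set P : ℂ → ℂ := fun w => 4 * w * (w - 1) * varpi0' w
  set Γ : ℝ → ℂ → ℂ × ℂ := fun t w => (P w,
    P w * (Complex.log (w * rot t) + ((α * t : ℝ) : ℂ) * Complex.I + (m w + 4 / w)) /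
      (Real.pi * Complex.I))
  have hc0U : c 0 ∈ legendreDomain := ⟨by rw [hc0]; exact Or.inl hre, hsub (hcr 0)⟩
  let γ : Path (c 0) z :=
    { toFun := fun t => c t
      continuous_toFun := hc.comp continuous_subtype_val
      source' := by simp
      target' := by simpa using hc1 }
  have hγ : ∀ t : unitInterval, γ t = c t := fun t => rfl
  refine ⟨Γ 1, ⟨c 0, hc0U, γ, fun t => hD ?_, fun t => Γ t, fun t => ?_, fun t => ?_, ?_, ?_⟩, ?_⟩
  · rw [mem_sphere_zero_iff_norm, hγ, hcn]
  · rw [hγ]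
    have hne : c t ≠ 0 := Complex.exp_ne_zero _
    have hP : AnalyticAt ℂ P (c t) := by
      have := differentiableOn_varpi0'.analyticAt (isOpen_oneSubSlit.mem_nhds (hsub (hcr t)))
      fun_prop
    have hma : AnalyticAt ℂ m (c t) := hm.analyticAt (isOpen_ball.mem_nhds (hcr t))
    have hl : AnalyticAt ℂ (fun w => Complex.log (w * rot t)) (c t) :=
      AnalyticAt.clog (by fun_prop) (by rw [hrot]; exact Or.inl hre)
    refine hP.prod ?_
    exact (hP.mul ((hl.add analyticAt_const).add (hma.add
      (analyticAt_const.div analyticAt_id hne)))).div analyticAt_const hpi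
  · have hcts : Tendsto (fun s : unitInterval => α * ((s : ℝ) - t)) (𝓝 t) (𝓝 0) := by
      have : Continuous fun s : unitInterval => α * ((s : ℝ) - t) := by fun_prop
      simpa using this.tendsto t
    have habs := hcts.abs
    rw [abs_zero] at habs
    filter_upwards [habs.eventually_lt_const (half_pos Real.pi_pos)] with s hs
    have hpos : ∀ᶠ w in 𝓝 (c s), 0 < (w * rot s).re := by
      have : Continuous fun w : ℂ => (w * rot s).re := by fun_prop
      refine this.continuousAt.eventually_const_lt ?_
      change 0 < (c s * rot s).re
      rw [hrot]
      exact hre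
    change ∀ᶠ w in 𝓝 (c s), Γ s w = Γ t w
    filter_upwards [hpos] with w hw
    have h1 : w * rot t = w * rot s * Complex.exp ((α * ((s : ℝ) - t) : ℝ) * Complex.I) := by
      rw [mul_assoc]
      congr 1
      simp only [rot]
      rw [← Complex.exp_add]
      congr 1
      push_cast
      ring
    simp only [Γ]
    rw [h1, log_mul_exp_add hw hs]
    congr 3
    push_cast
    ring
  · filter_upwards [isOpen_legendreDomain.mem_nhds hc0U, isOpen_ball.mem_nhds (hcr 0)] with w hw hwr
    have h1 := hlog w ⟨hwr, hw.1⟩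
    rw [bpsPeriods_eq hw] at h1 ⊢
    simp only [Γ, rot, P, Prod.mk.injEq, true_and]
    simp only [Icc.coe_zero, mul_zero, Complex.ofReal_zero, neg_zero, zero_mul, Complex.exp_zero,
      mul_one, add_zero]
    rw [div_eq_iff hpi]
    linear_combination -h1
  · simp
  · have h1 : z * rot 1 = ((Real.exp L.re : ℝ) : ℂ) := by
      rw [← hc1, hrot, Complex.ofReal_exp]
    have h2 : Complex.log (z * rot 1) + ((α * 1 : ℝ) : ℂ) * Complex.I = L := by
      rw [h1, ← Complex.ofReal_log (Real.exp_pos _).le, Real.log_exp, mul_one, Complex.re_add_im]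
    simp only [Γ, P]
    rw [h2]

/-- Near `0`, every branch of the BPS periods satisfies the exponential relation. -/
lemma IsBranchAt.exp_ratio (hr1 : r ≤ 1) (hne : ∀ lam ∈ ball (0 : ℂ) r, varpi0' lam ≠ 0)
    (hm : DifferentiableOn ℂ m (ball 0 r))
    (hlog : ∀ lam ∈ ball (0 : ℂ) r ∩ Complex.slitPlane,
        (Real.pi : ℂ) * Complex.I * (bpsPeriods lam).2 =
          (bpsPeriods lam).1 * (Complex.log lam + (m lam + 4 / lam)))
    {z : ℂ} (hz : z ∈ ball (0 : ℂ) r \ {0}) {g : ℂ → ℂ × ℂ}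
    (hg : IsBranchAt bpsPeriods legendreDomain (ball 0 r \ {0}) z g) :
    (g z).1 ≠ 0 ∧ Complex.exp ((Real.pi : ℂ) * Complex.I * ((g z).2 / (g z).1)) =
      z * Complex.exp (m z + 4 / z) := by
  have hsub : ball (0 : ℂ) r ⊆ oneSubSlit := ball_subset_oneSubSlit hr1
  set P : ℂ → ℂ := fun w => 4 * w * (w - 1) * varpi0' w
  have hP0 : ∀ w ∈ ball (0 : ℂ) r \ {0}, P w ≠ 0 := fun w hw => by
    have h1 : w - 1 ≠ 0 := by
      rw [← neg_ne_zero, neg_sub]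
      exact Complex.slitPlane_ne_zero (hsub hw.1)
    exact mul_ne_zero (mul_ne_zero (mul_ne_zero (by norm_num) hw.2) h1) (hne w hw.1)
  have hPa : ∀ w ∈ ball (0 : ℂ) r \ {0}, AnalyticAt ℂ P w := fun w hw => by
    have := differentiableOn_varpi0'.analyticAt (isOpen_oneSubSlit.mem_nhds (hsub hw.1))
    fun_prop
  have hopen : IsOpen (legendreDomain ∩ (ball (0 : ℂ) r \ {0})) :=
    isOpen_legendreDomain.inter (isOpen_ball.sdiff isClosed_singleton)
  have h1 : (g z).1 - P z = 0 := by
    refine hg.relation hopen (R := fun w p => p.1 - P w) (fun w hw G hG => ?_) fun w hw => ?_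
    · exact (analyticAt_fst.comp hG).sub (hPa w hw)
    · simp only [bpsPeriods_eq hw.1, P, sub_self]
  -- The logarithm is multi-valued but its exponential is not. Dividing by the single-valued `P`,
  -- already identified with the first component, keeps the relation analytic on every germ.
  have h2 : Complex.exp ((Real.pi : ℂ) * Complex.I * ((g z).2 / P z)) -
      z * Complex.exp (m z + 4 / z) = 0 := by
    refine hg.relation hopen (R := fun w p => Complex.exp ((Real.pi : ℂ) * Complex.I *
      (p.2 / P w)) - w * Complex.exp (m w + 4 / w)) (fun w hw G hG => ?_) fun w hw => ?_
    · have hma : AnalyticAt ℂ m w := hm.analyticAt (isOpen_ball.mem_nhds hw.1)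
      have hG2 : AnalyticAt ℂ (fun w => (G w).2) w := analyticAt_snd.comp hG
      exact (AnalyticAt.cexp (analyticAt_const.mul (hG2.div (hPa w hw) (hP0 w hw)))).sub
        (analyticAt_id.mul (AnalyticAt.cexp (hma.add
          (analyticAt_const.div analyticAt_id hw.2))))
    · have h3 := hlog w ⟨hw.2.1, hw.1.1⟩
      have h4 : (bpsPeriods w).1 = P w := by rw [bpsPeriods_eq hw.1]
      rw [h4] at h3
      have h5 := hP0 w hw.2
      have h6 : (Real.pi : ℂ) * Complex.I * ((bpsPeriods w).2 / P w) =
          Complex.log w + (m w + 4 / w) := by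
        rw [← mul_div_assoc, h3, mul_div_cancel_left₀ _ h5]
      rw [h6, Complex.exp_add, Complex.exp_log hw.2.2, sub_self]
  rw [sub_eq_zero] at h1 h2
  rw [h1]
  exact ⟨hP0 z hz, h2⟩

/-- In every punctured neighbourhood of `0` the period ratio takes every value. -/
lemma infinite_quotientFiber_bpsPeriods (hr : 0 < r) (hr1 : r ≤ 1)
    (hne : ∀ lam ∈ ball (0 : ℂ) r, varpi0' lam ≠ 0)
    (hm : DifferentiableOn ℂ m (ball 0 r))
    (hlog : ∀ lam ∈ ball (0 : ℂ) r ∩ Complex.slitPlane,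
        (Real.pi : ℂ) * Complex.I * (bpsPeriods lam).2 =
          (bpsPeriods lam).1 * (Complex.log lam + (m lam + 4 / lam)))
    {N : Set ℂ} (hN : N ∈ 𝓝 (0 : ℂ)) (t : ℂ) :
    (quotientFiber bpsPeriods legendreDomain (N \ {0}) t).Infinite := by
  obtain ⟨δ, hδ, hball⟩ := Metric.mem_nhds_iff.1 (inter_mem hN (ball_mem_nhds (0 : ℂ) hr))
  refine infinite_of_forall_nhds (z₀ := 0) (fun h => h.1.2 rfl) fun V hV => ?_
  -- The equation for c = 16 exp(π i t) says exactly that π i t - (m z + 4 / z) is a logarithm of z.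
  -- The branch attached to that logarithm has ratio t.
  obtain ⟨z, ⟨⟨hzV, hzδ⟩, hz0⟩, hz⟩ := exists_mul_exp_add_div_eq hr hm
    (mul_ne_zero (by norm_num : (16 : ℂ) ≠ 0) (Complex.exp_ne_zero ((Real.pi : ℂ) * Complex.I * t)))
    (inter_mem hV (ball_mem_nhds (0 : ℂ) hδ))
  have hpi : (Real.pi : ℂ) * Complex.I ≠ 0 :=
    mul_ne_zero (by exact_mod_cast Real.pi_ne_zero) Complex.I_ne_zero
  have hexp : Complex.exp ((Real.pi : ℂ) * Complex.I * t - (m z + 4 / z)) = z := by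
    rw [Complex.exp_sub, div_eq_iff (Complex.exp_ne_zero _)]
    linear_combination -(1 / 16 : ℂ) * hz
  have hzr := (hball hzδ).2
  have hsphere : sphere (0 : ℂ) ‖z‖ ⊆ N \ {0} := fun w hw => by
    rw [mem_sphere_zero_iff_norm] at hw
    refine ⟨(hball ?_).1, ?_⟩
    · rw [mem_ball_zero_iff, hw]
      exact mem_ball_zero_iff.1 hzδ
    · rintro rfl
      rw [norm_zero] at hw
      exact hz0 (norm_eq_zero.1 hw.symm)
  obtain ⟨g, hg, hgz⟩ := exists_isBranchAt hr1 hm hlog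
    (L := (Real.pi : ℂ) * Complex.I * t - (m z + 4 / z)) (D := N \ {0})
    (by rw [hexp]; exact mem_ball_zero_iff.1 hzr) (by rw [hexp]; exact hsphere)
  rw [hexp] at hg hgz
  have hP : 4 * z * (z - 1) * varpi0' z ≠ 0 := by
    have h1 : z - 1 ≠ 0 := by
      rw [← neg_ne_zero, neg_sub]
      exact Complex.slitPlane_ne_zero (ball_subset_oneSubSlit hr1 hzr)
    exact mul_ne_zero (mul_ne_zero (mul_ne_zero (by norm_num) hz0) h1) (hne z hzr)
  refine ⟨z, hzV, ⟨(hball hzδ).1, hz0⟩, g, hg, ?_, ?_⟩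
  · rw [hgz]
    exact hP
  · rw [hgz, sub_add_cancel]
    dsimp only
    generalize 4 * z * (z - 1) * varpi0' z = P at hP ⊢
    rw [div_div, div_eq_iff (mul_ne_zero hpi hP)]
    ring

end Branches

/-! ### Transfer to lam = 1 and to u = ∓1. -/

lemma two_mul_mem_slitPlane {z : ℂ} (h : z ∈ Complex.slitPlane) : 2 * z ∈ Complex.slitPlane := by
  rcases h with h | h
  · exact Or.inl (by simpa using h)
  · exact Or.inr (by simpa using h)

lemma two_mul_sub_one_mem_swDomain {lam : ℂ} (h : lam ∈ legendreDomain) :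
    2 * lam - 1 ∈ swDomain := by
  constructor
  · rw [add_sub_cancel]
    exact two_mul_mem_slitPlane h.1
  · rw [show 1 - (2 * lam - 1) = 2 * (1 - lam) by ring]
    exact two_mul_mem_slitPlane h.2

/-- The linear map `(a, b) ↦ (i b, -i a)` that relates the periods at `lam` and `1 - lam`. -/
def dualMap : ℂ × ℂ →L[ℂ] ℂ × ℂ :=
  (Complex.I • ContinuousLinearMap.snd ℂ ℂ ℂ).prod (-Complex.I • ContinuousLinearMap.fst ℂ ℂ ℂ)

/-- The linear map that expresses `(a, a_D)` by `(π₀, π₁)`. -/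
def swMap : ℂ × ℂ →L[ℂ] ℂ × ℂ :=
  (-ContinuousLinearMap.fst ℂ ℂ ℂ - ContinuousLinearMap.snd ℂ ℂ ℂ).prod
    (-ContinuousLinearMap.snd ℂ ℂ ℂ)

lemma dualMap_apply (p : ℂ × ℂ) : dualMap p = (Complex.I * p.2, -Complex.I * p.1) := rfl

lemma swMap_apply (p : ℂ × ℂ) : swMap p = (-p.1 - p.2, -p.2) := rfl

lemma IsBranchAt.one_sub {D D' : Set ℂ} {z : ℂ} {g : ℂ → ℂ × ℂ}
    (h : IsBranchAt bpsPeriods legendreDomain D z g) (hD : ∀ w ∈ D, 1 - w ∈ D') :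
    IsBranchAt bpsPeriods legendreDomain D' (1 - z) (fun w => dualMap (g (1 - w))) :=
  h.transport (ψ := fun w => 1 - w) (φ := fun w => 1 - w) isOpen_legendreDomain (by fun_prop)
    (by fun_prop) (fun w => sub_sub_cancel 1 w) (fun w => sub_sub_cancel 1 w) dualMap
    (fun _ hw => bpsPeriods_one_sub hw) (fun _ hw => one_sub_mem_legendreDomain hw) hD

/-- Transport of infinite fibres from `0` along `w ↦ α w + β`. -/
lemma takesRealValuesNear_of_fibers
    (hfib : ∀ N ∈ 𝓝 (0 : ℂ), ∀ t : ℂ,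
      (quotientFiber bpsPeriods legendreDomain (N \ {0}) t).Infinite)
    {f : ℂ → ℂ × ℂ} {U : Set ℂ} {α β : ℂ} (hα : α ≠ 0) (M : ℂ × ℂ →L[ℂ] ℂ × ℂ)
    (hf : ∀ w ∈ legendreDomain, f (α * w + β) = M (bpsPeriods w))
    (hU : ∀ w ∈ legendreDomain, α * w + β ∈ U) {e : ℝ} {s : ℂ → ℂ}
    (hs : ∀ t : ℂ, t ≠ e → ∀ p : ℂ × ℂ, p.1 ≠ 0 → p.2 / p.1 = s t →
      (M p).1 ≠ 0 ∧ (M p).2 / (M p).1 = t) :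
    TakesRealValuesNear f U β := by
  refine ⟨e, fun N hN t ht => ?_⟩
  have hψ : Continuous fun w : ℂ => α * w + β := by fun_prop
  have hN0 : (fun w : ℂ => α * w + β) ⁻¹' N ∈ 𝓝 (0 : ℂ) :=
    hψ.continuousAt.preimage_mem_nhds (by simpa using hN)
  have hinj : Function.Injective fun w : ℂ => α * w + β := fun x y hxy =>
    mul_left_cancel₀ hα (add_right_cancel hxy)
  refine (((hfib _ hN0 (s t)).image hinj.injOn).mono ?_)
  refine image_quotientFiber_subset isOpen_legendreDomain hψ (φ := fun z => (z - β) / α)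
    (by fun_prop) (fun w => by field_simp; ring) (fun w => by field_simp; ring) M hf hU ?_
    (hs t (by exact_mod_cast ht))
  rintro w ⟨hw, hw0⟩
  exact ⟨hw, fun h => hw0 (mul_left_cancel₀ hα (by simpa using h))⟩

lemma isBigO_mul_exp {m : ℂ → ℂ} (hm : DifferentiableAt ℂ m 0)
    (hm0 : m 0 = -(Real.log 16 : ℂ) - 3 / 2) :
    (fun lam : ℂ => 16 * lam * Complex.exp (m lam) - Complex.exp (-3 / 2) * lam) =O[𝓝 0]
      fun lam : ℂ => lam ^ 2 := by
  have h1 : Complex.exp (-3 / 2) = 16 * Complex.exp (m 0) := by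
    rw [hm0, Complex.exp_sub, Complex.exp_neg, ← Complex.ofReal_exp, Real.exp_log (by norm_num),
      neg_div, Complex.exp_neg]
    push_cast
    field_simp
  have h2 := (hm.cexp.isBigO_sub).const_mul_left 16
  have h3 := (Asymptotics.isBigO_refl (fun lam : ℂ => lam) (𝓝 0)).mul h2
  refine (h3.congr_left fun lam => ?_).congr_right fun lam => ?_
  · rw [h1]; ring
  · ring

end SeibergWitten

end

theorem mainTheorem3 :
    (∃ r : ℝ, 0 < r ∧ ∃ F : ℂ → ℂ,
      DifferentiableOn ℂ F (Metric.ball 0 r) ∧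
      ((fun lam : ℂ => F lam - Complex.exp (-3 / 2) * lam) =O[𝓝 0] fun lam : ℂ => lam ^ 2) ∧
      -- near `lam = 0`: every branch of `φ = π₁ / π₀` satisfies `16 exp (π i φ) = F exp (4 / lam)`
      (∀ lam ∈ Metric.ball (0 : ℂ) r \ {0},
        (∃ g, SeibergWitten.IsBranchAt SeibergWitten.bpsPeriods SeibergWitten.legendreDomain
          (Metric.ball 0 r \ {0}) lam g) ∧
        ∀ g, SeibergWitten.IsBranchAt SeibergWitten.bpsPeriods SeibergWitten.legendreDomain
          (Metric.ball 0 r \ {0}) lam g →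
          (g lam).1 ≠ 0 ∧
          16 * Complex.exp ((Real.pi : ℂ) * Complex.I * ((g lam).2 / (g lam).1)) =
            F lam * Complex.exp (4 / lam)) ∧
      SeibergWitten.HasEssentialSingularityAt (fun lam => F lam * Complex.exp (4 / lam)) 0 ∧
      (∃ e : ℂ, ∀ N ∈ 𝓝 (0 : ℂ), ∀ c : ℂ, c ≠ e →
        {lam | lam ∈ N \ {0} ∧ F lam * Complex.exp (4 / lam) = c}.Infinite) ∧
      -- near `lam = 1`: the same relation for `-1 / φ = - π₀ / π₁`, at `1 - lam`
      (∀ lam ∈ Metric.ball (1 : ℂ) r \ {1},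
        (∃ g, SeibergWitten.IsBranchAt SeibergWitten.bpsPeriods SeibergWitten.legendreDomain
          (Metric.ball 1 r \ {1}) lam g) ∧
        ∀ g, SeibergWitten.IsBranchAt SeibergWitten.bpsPeriods SeibergWitten.legendreDomain
          (Metric.ball 1 r \ {1}) lam g →
          (g lam).2 ≠ 0 ∧
          16 * Complex.exp ((Real.pi : ℂ) * Complex.I * (-((g lam).1 / (g lam).2))) =
            F (1 - lam) * Complex.exp (4 / (1 - lam)))) ∧
    -- real values of `φ` near `lam = 0, 1` and of `a_D / a` near `u = -1, 1`
    SeibergWitten.TakesRealValuesNear SeibergWitten.bpsPeriods SeibergWitten.legendreDomain 0 ∧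
    SeibergWitten.TakesRealValuesNear SeibergWitten.bpsPeriods SeibergWitten.legendreDomain 1 ∧
    SeibergWitten.TakesRealValuesNear SeibergWitten.swPeriods SeibergWitten.swDomain (-1) ∧
    SeibergWitten.TakesRealValuesNear SeibergWitten.swPeriods SeibergWitten.swDomain 1 := by
  open SeibergWitten in
  obtain ⟨r, hr, hr1, hne, m, hm, hm0, hlog⟩ := exists_log_structure
  have hfib : ∀ N ∈ 𝓝 (0 : ℂ), ∀ t : ℂ,
      (quotientFiber bpsPeriods legendreDomain (N \ {0}) t).Infinite := fun N hN t =>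
    infinite_quotientFiber_bpsPeriods hr hr1 hne hm hlog hN t
  have hF : ∀ lam : ℂ, 16 * lam * Complex.exp (m lam) * Complex.exp (4 / lam) =
      16 * lam * Complex.exp (m lam + 4 / lam) := fun lam => by
    rw [Complex.exp_add, mul_assoc]
  have hvalues : ∀ c : ℂ, c ≠ 0 → ∀ N ∈ 𝓝 (0 : ℂ),
      ∃ lam ∈ N \ {0}, 16 * lam * Complex.exp (m lam) * Complex.exp (4 / lam) = c := by
    simp only [hF]
    exact fun c hc N hN => exists_mul_exp_add_div_eq hr hm hc hN
  have hm' := hm.differentiableAt (ball_mem_nhds (0 : ℂ) hr)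
  have hball1 : ∀ w ∈ ball (0 : ℂ) r \ {0}, 1 - w ∈ ball (1 : ℂ) r \ {1} := fun w hw => by
    refine ⟨?_, fun h => hw.2 (by simpa using h)⟩
    simpa [mem_ball, dist_eq_norm] using hw.1
  have hball0 : ∀ w ∈ ball (1 : ℂ) r \ {1}, 1 - w ∈ ball (0 : ℂ) r \ {0} := fun w hw => by
    refine ⟨?_, fun h => hw.2 (sub_eq_zero.1 h).symm⟩
    simpa [mem_ball, dist_eq_norm, norm_sub_rev] using hw.1
  have hexists : ∀ lam ∈ ball (0 : ℂ) r \ {0},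
      ∃ g, IsBranchAt bpsPeriods legendreDomain (ball 0 r \ {0}) lam g := fun lam hlam => by
    have hexp := Complex.exp_log hlam.2
    have hn := mem_ball_zero_iff.1 hlam.1
    obtain ⟨g, hg, -⟩ := exists_isBranchAt hr1 hm hlog (L := Complex.log lam)
      (D := ball 0 r \ {0}) (by rwa [hexp]) (by
        rw [hexp]
        intro w hw
        rw [mem_sphere_zero_iff_norm] at hw
        refine ⟨by rwa [mem_ball_zero_iff, hw], fun h => hlam.2 ?_⟩
        rw [mem_singleton_iff.1 h, norm_zero] at hw
        exact norm_eq_zero.1 hw.symm)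
    rw [hexp] at hg
    exact ⟨g, hg⟩
  have hrel : ∀ lam ∈ ball (0 : ℂ) r \ {0}, ∀ g,
      IsBranchAt bpsPeriods legendreDomain (ball 0 r \ {0}) lam g →
      (g lam).1 ≠ 0 ∧ 16 * Complex.exp ((Real.pi : ℂ) * Complex.I * ((g lam).2 / (g lam).1)) =
        16 * lam * Complex.exp (m lam) * Complex.exp (4 / lam) := fun lam hlam g hg => by
    obtain ⟨h1, h2⟩ := hg.exp_ratio hr1 hne hm hlog hlam
    refine ⟨h1, ?_⟩
    rw [h2, hF, mul_assoc]
  refine ⟨⟨r, hr, fun lam => 16 * lam * Complex.exp (m lam), ?_, isBigO_mul_exp hm' hm0,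
    fun lam hlam => ⟨hexists lam hlam, hrel lam hlam⟩, ⟨?_, ?_⟩, ⟨0, fun N hN c hc => ?_⟩,
    fun lam hlam => ⟨?_, fun g hg => ?_⟩⟩, ?_, ?_, ?_, ?_⟩
  · exact DifferentiableOn.mul (by fun_prop) hm.cexp
  · filter_upwards [self_mem_nhdsWithin, mem_nhdsWithin_of_mem_nhds (ball_mem_nhds 0 hr)]
      with z hz hzr
    have h1 := hm.differentiableAt (isOpen_ball.mem_nhds hzr)
    have h2 : z ≠ 0 := hz
    fun_prop (disch := assumption)
  · refine not_meromorphicAt_of_values fun c hc => frequently_iff.2 fun {V} hV => ?_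
    obtain ⟨N, hN, hNV⟩ := mem_nhdsWithin_iff_exists_mem_nhds_inter.1 hV
    obtain ⟨lam, hlam, h⟩ := hvalues c hc N hN
    exact ⟨lam, hNV hlam, h⟩
  · refine infinite_of_forall_nhds (fun h => h.1.2 rfl) fun V hV => ?_
    obtain ⟨lam, hlam, h⟩ := hvalues c hc _ (inter_mem hV hN)
    exact ⟨lam, hlam.1.1, ⟨hlam.1.2, hlam.2⟩, h⟩
  · obtain ⟨g, hg⟩ := hexists _ (hball0 lam hlam)
    have h := hg.one_sub hball1
    rw [sub_sub_cancel] at h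
    exact ⟨_, h⟩
  · obtain ⟨h1, h2⟩ := hrel _ (hball0 lam hlam) _ (hg.one_sub hball0)
    rw [sub_sub_cancel, dualMap_apply] at h1 h2
    have h3 := right_ne_zero_of_mul h1
    refine ⟨h3, ?_⟩
    rw [← h2]
    congr 3
    have hI := Complex.I_ne_zero
    dsimp only
    field_simp
  · refine takesRealValuesNear_of_fibers hfib one_ne_zero (ContinuousLinearMap.id ℂ _) (e := 0)
      (s := id) (fun w _ => by simp) (fun w hw => by simpa using hw)
      fun t _ p hp h => ⟨hp, h⟩
  · refine takesRealValuesNear_of_fibers hfib (neg_ne_zero.2 one_ne_zero) dualMap (e := 0)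
      (s := fun t => -1 / t) (fun w hw => ?_) (fun w hw => ?_) fun t ht p hp h => ?_
    · rw [neg_one_mul, neg_add_eq_sub, bpsPeriods_one_sub hw, dualMap_apply]
    · rw [neg_one_mul, neg_add_eq_sub]
      exact one_sub_mem_legendreDomain hw
    · have ht' : t ≠ 0 := by simpa using ht
      have hI := Complex.I_ne_zero
      rw [div_eq_iff hp] at h
      rw [dualMap_apply, h]
      refine ⟨mul_ne_zero hI (mul_ne_zero (div_ne_zero (by norm_num) ht') hp), ?_⟩
      dsimp only
      field_simp
  -- Here a_D / a = φ / (1 + φ), with inverse t / (1 - t); the value 1 corresponds to φ = ∞.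
  · refine takesRealValuesNear_of_fibers hfib two_ne_zero swMap (e := 1)
      (s := fun t => t / (1 - t)) (fun w hw => ?_) (fun w hw => ?_) fun t ht p hp h => ?_
    · rw [← sub_eq_add_neg, swPeriods_eq hw, swMap_apply]
    · rw [← sub_eq_add_neg]
      exact two_mul_sub_one_mem_swDomain hw
    · have ht' : 1 - t ≠ 0 := sub_ne_zero.2 (by simpa using ht.symm)
      rw [div_eq_iff hp] at h
      have h1 : -p.1 - p.2 = -(p.1 / (1 - t)) := by
        rw [h]
        field_simp
        ring
      rw [swMap_apply, h1, h]
      refine ⟨neg_ne_zero.2 (div_ne_zero hp ht'), ?_⟩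
      dsimp only
      field_simp
  -- After the reflection a_D / a = 1 / (1 - φ), with φ taken at the reflected point near 0; the
  -- value 0 corresponds to φ = ∞.
  · refine takesRealValuesNear_of_fibers hfib (neg_ne_zero.2 two_ne_zero) (swMap.comp dualMap)
      (e := 0) (s := fun t => 1 - 1 / t) (fun w hw => ?_) (fun w hw => ?_) fun t ht p hp h => ?_
    · rw [show -2 * w + 1 = 2 * (1 - w) - 1 by ring, swPeriods_eq (one_sub_mem_legendreDomain hw),
        bpsPeriods_one_sub hw]
      rfl
    · rw [show -2 * w + 1 = 2 * (1 - w) - 1 by ring]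
      exact two_mul_sub_one_mem_swDomain (one_sub_mem_legendreDomain hw)
    · have ht' : t ≠ 0 := by simpa using ht
      have hI := Complex.I_ne_zero
      rw [div_eq_iff hp] at h
      have h1 : swMap.comp dualMap p = (Complex.I * p.1 / t, Complex.I * p.1) := by
        rw [ContinuousLinearMap.comp_apply, dualMap_apply, swMap_apply, h]
        refine Prod.ext ?_ ?_
        · dsimp only
          field_simp
          ring
        · dsimp only
          ring
      rw [h1]
      refine ⟨div_ne_zero (mul_ne_zero hI hp) ht', ?_⟩
      dsimp only
      field_simp
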